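/- Theorem 3.3. Let $(M,g_1)$ and $(B,g_2)$ be smooth finite-dimensional Riemannian manifolds without boundary. Let $B$ carry an almost contact metric structure $(\psi,\xi,\eta)$: a smooth $(1,1)$-tensor field $\psi$, vector field $\xi$ and $1$-form $\eta$ with $$\psi^2=-I+\eta\otimes\xi,\quad \psi\xi=0,\quad \eta\circ\psi=0,\quad \eta(\xi)=1,$$ $$g_2(\psi W,\psi Z)=g_2(W,Z)-\eta(W)\eta(Z),\quad g_2(\psi W,Z)=-g_2(W,\psi Z),\quad \eta(W)=g_2(W,\xi).$$ Assume that $B$ is trans-Sasakian of type $(\alpha,\beta)$, i.e. for smooth functions $\alpha,\beta$ on $B$, with $\nabla^B$ the Levi-Civita connection, $$(\nabla^B_W\psi)Z=\alpha\,(g_2(W,Z)\xi-\eta(Z)W)+\beta\,(g_2(\psi W,Z)\xi-\eta(Z)\psi W).$$ Let $\pi:M\to B$ be a Riemannian map, i.e. a smooth map with $g_2(\pi_*W,\pi_*Z)=g_1(W,Z)$ for $W,Z\in(\ker\pi_{*p})^\perp$, $p\in M$. Assume that $\pi$ is anti-invariant, $\psi(\mathrm{range}\,\pi_{*p})\subseteq(\mathrm{range}\,\pi_{*p})^\perp$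 for all $p$, and that the Reeb field is horizontal, $\xi_{\pi(p)}\in(\mathrm{range}\,\pi_{*p})^\perp$ for all $p$. Let $h:B\to\mathbb R$ be smooth, and let $\pi$ be a Clairaut map with $r=e^h$ in at least one of the following two senses: (a) there are an open set $U\supseteq\pi(M)$ and a smooth distribution $D$ on $U$ with $D_{\pi(p)}=\mathrm{range}\,\pi_{*p}$ for all $p\in M$, such that for every geodesic $\Omega$ of $B$ that is defined on an open interval and lies in $U$, the function $(r\circ\Omega)\sin\theta$ is constant, where $\theta(s)$ is the angle between $\dot\Omega(s)$ and its component $V(s)\in D^\perp$ (with $\theta=\pi/2$ if $V(s)=0$); (b) $\pi$ is umbilical with mean curvature vector field $H=-\nabla^Bh$: the second fundamental form $(\nabla\pi_*)(W,Z)=\nabla^\pi_W\pi_*Z-\pi_*(\nabla^M_WZ)$, where $\nabla^\pi$ is the pullback of $\nabla^B$ along $\pi$, satisfies $(\nabla\pi_*)(W,Z)=-g_1(W,Z)\,\nabla^Bh$ for $W,Z\in(\ker\pi_*)^\perp$. Then, at every $p\in M$, either $\dim(\mathrm{range}\,\pi_{*p})=1$ or $h$ is constant along $\psi(\mathrm{range}\,\pi_{*p})$,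 i.e. $dh_{\pi(p)}(\psi\,\pi_*W)=0$ for all $W\in T_pM$. If $M$ is connected, then either $\dim(\mathrm{range}\,\pi_*)=1$ on all of $M$, or $h$ is constant along $\psi(\mathrm{range}\,\pi_*)$ on all of $M$. -/

import Mathlib

open Bundle Set Filter
open scoped Manifold ContDiff Topology

noncomputable section

/-! ## Levi-Civita calculus in charts

Manifolds are smooth, finite dimensional and without boundary: they are modelled on `𝓘(ℝ, F)` for a
finite dimensional real vector space `F`. The Riemannian metric is Mathlib's
`RiemannianBundle` structure on the tangent bundle. -/

section LeviCivita

variable {F : Type*} [NormedAddCommGroup F] [NormedSpace ℝ F] [FiniteDimensional ℝ F]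
  {B : Type*} [TopologicalSpace B] [ChartedSpace F B] [IsManifold 𝓘(ℝ, F) ∞ B]

/-- Components of tangent vectors at `x` in the chart centred at `c` (for `x` in its domain). -/
def coordVec (c x : B) : TangentSpace 𝓘(ℝ, F) x →L[ℝ] F :=
  mvfderiv 𝓘(ℝ, F) (extChartAt 𝓘(ℝ, F) c) x

/-- The tangent vector at `x` with given components in the chart centred at `c`. -/
def ofCoordVec (c x : B) : F →L[ℝ] TangentSpace 𝓘(ℝ, F) x :=
  (coordVec c x).inverse

/-- A vector field is smooth on a set. -/
def SmoothFieldOn (X : ∀ x : B, TangentSpace 𝓘(ℝ, F) x) (U : Set B) : Prop :=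
  ContMDiffOn 𝓘(ℝ, F) (𝓘(ℝ, F).prod 𝓘(ℝ, F)) ∞ (fun x ↦ TotalSpace.mk' F x (X x)) U

variable [RiemannianBundle (fun x : B ↦ TangentSpace 𝓘(ℝ, F) x)]

/-- The metric in the chart centred at `c`: `g_y(u, v)` for `y` in the chart target. -/
def metricCoord (c : B) (y u v : F) : ℝ :=
  inner ℝ (ofCoordVec c ((extChartAt 𝓘(ℝ, F) c).symm y) u)
    (ofCoordVec c ((extChartAt 𝓘(ℝ, F) c).symm y) v)

/-- Christoffel symbols of the first kind,
`½ (∂_u g(v, w) + ∂_v g(u, w) - ∂_w g(u, v))`, in the chart centred at `c`. -/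
def christoffelFirst (c : B) (y u v w : F) : ℝ :=
  (fderiv ℝ (fun z ↦ metricCoord c z v w) y u + fderiv ℝ (fun z ↦ metricCoord c z u w) y v
    - fderiv ℝ (fun z ↦ metricCoord c z u v) y w) / 2

/-- The Gram matrix `(g_{ij})` in the chart centred at `c`. -/
def gramMatrix (c : B) (y : F) :
    Matrix (Fin (Module.finrank ℝ F)) (Fin (Module.finrank ℝ F)) ℝ :=
  Matrix.of fun i j ↦ metricCoord c y (Module.finBasis ℝ F i) (Module.finBasis ℝ F j)

/-- Christoffel symbols of the second kind: `Γ(u, v) = ∑_k (∑_l g^{kl} Γ_l(u, v)) e_k`. -/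
def christoffel (c : B) (y u v : F) : F :=
  ∑ k, (∑ l, (gramMatrix c y)⁻¹ k l * christoffelFirst c y u v (Module.finBasis ℝ F l)) •
    Module.finBasis ℝ F k

variable {E : Type*} [NormedAddCommGroup E] [NormedSpace ℝ E]
  {N : Type*} [TopologicalSpace N] [ChartedSpace E N]

/-- The covariant derivative `∇^f_w V` at `p` of a vector field `V` along a map `f : N → B`, for the
pullback of the Levi-Civita connection of `B`, computed in the chart of `B` centred at `c`:
`∂_w V^k + Γ^k_{ij} (df w)^i V^j`. The result does not depend on `c`, as long as `f p` lies in the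
domain of that chart. -/
def covDerivAlongIn (c : B) (f : N → B) (V : ∀ q : N, TangentSpace 𝓘(ℝ, F) (f q))
    (p : N) (w : TangentSpace 𝓘(ℝ, E) p) : TangentSpace 𝓘(ℝ, F) (f p) :=
  ofCoordVec c (f p)
    (mvfderiv 𝓘(ℝ, E) (fun q ↦ coordVec c (f q) (V q)) p w +
      christoffel c (extChartAt 𝓘(ℝ, F) c (f p))
        (coordVec c (f p) (mfderiv 𝓘(ℝ, E) 𝓘(ℝ, F) f p w)) (coordVec c (f p) (V p)))

/-- The pullback `∇^f_w V` of the Levi-Civita connection of `B` along `f : N → B`. -/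
def covDerivAlong (f : N → B) (V : ∀ q : N, TangentSpace 𝓘(ℝ, F) (f q))
    (p : N) (w : TangentSpace 𝓘(ℝ, E) p) : TangentSpace 𝓘(ℝ, F) (f p) :=
  covDerivAlongIn (f p) f V p w

/-- The Levi-Civita covariant derivative `∇_w X` of a vector field `X` on `B`. -/
def leviCivita (X : ∀ x : B, TangentSpace 𝓘(ℝ, F) x) (b : B) (w : TangentSpace 𝓘(ℝ, F) b) :
    TangentSpace 𝓘(ℝ, F) b :=
  covDerivAlong (fun x : B ↦ x) X b w

/-- The velocity of a curve. -/
def velocity (Ω : ℝ → B) (s : ℝ) : TangentSpace 𝓘(ℝ, F) (Ω s) :=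
  mfderiv 𝓘(ℝ, ℝ) 𝓘(ℝ, F) Ω s (1 : ℝ)

/-- `Ω` is a geodesic on the open interval `J`: it is `C²` there and `∇_Ω' Ω' = 0`. The equation may
be checked in any chart, since it does not depend on the chart. -/
def IsGeodesicOn (Ω : ℝ → B) (J : Set ℝ) : Prop :=
  ContMDiffOn 𝓘(ℝ, ℝ) 𝓘(ℝ, F) 2 Ω J ∧
  ∀ s ∈ J, ∃ c : B, Ω s ∈ (chartAt F c).source ∧
    covDerivAlongIn c Ω (velocity (F := F) Ω) s (1 : ℝ) = 0

end LeviCivita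

/-! ## Trans-Sasakian manifolds -/

section TransSasakian

variable (F : Type*) [NormedAddCommGroup F] [NormedSpace ℝ F] [FiniteDimensional ℝ F]
  (B : Type*) [TopologicalSpace B] [ChartedSpace F B] [IsManifold 𝓘(ℝ, F) ∞ B]
  [RiemannianBundle (fun x : B ↦ TangentSpace 𝓘(ℝ, F) x)]

/-- An almost contact metric structure `(ψ, ξ, η)` compatible with the metric of `B`. -/
structure AlmostContactMetric where
  /-- the `(1,1)`-tensor -/
  ψ : ∀ b : B, TangentSpace 𝓘(ℝ, F) b →L[ℝ] TangentSpace 𝓘(ℝ, F) b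
  /-- the Reeb vector field -/
  ξ : ∀ b : B, TangentSpace 𝓘(ℝ, F) b
  /-- the contact form -/
  η : ∀ b : B, TangentSpace 𝓘(ℝ, F) b →L[ℝ] ℝ
  smooth_ψ : ContMDiff 𝓘(ℝ, F) (𝓘(ℝ, F).prod 𝓘(ℝ, F →L[ℝ] F)) ∞
    (fun b ↦ TotalSpace.mk' (F →L[ℝ] F)
      (E := fun b : B ↦ TangentSpace 𝓘(ℝ, F) b →L[ℝ] TangentSpace 𝓘(ℝ, F) b) b (ψ b))
  smooth_ξ : SmoothFieldOn ξ univ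
  smooth_η : ContMDiff 𝓘(ℝ, F) (𝓘(ℝ, F).prod 𝓘(ℝ, F →L[ℝ] ℝ)) ∞
    (fun b ↦ TotalSpace.mk' (F →L[ℝ] ℝ)
      (E := fun b : B ↦ TangentSpace 𝓘(ℝ, F) b →L[ℝ] Trivial B ℝ b) b (η b))
  ψ_ψ : ∀ b v, ψ b (ψ b v) = -v + η b v • ξ b
  ψ_ξ : ∀ b, ψ b (ξ b) = 0
  η_ψ : ∀ b v, η b (ψ b v) = 0
  η_ξ : ∀ b, η b (ξ b) = 1
  inner_ψ_ψ : ∀ b v w, inner ℝ (ψ b v) (ψ b w) = inner ℝ v w - η b v * η b w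
  inner_ψ : ∀ b v w, inner ℝ (ψ b v) w = -inner ℝ v (ψ b w)
  η_eq : ∀ b v, η b v = inner ℝ v (ξ b)

variable {F B}

/-- `B` is trans-Sasakian of type `(α, β)`:
`(∇_W ψ)Z = α (g(W,Z) ξ - η(Z) W) + β (g(ψW,Z) ξ - η(Z) ψW)` with smooth `α`, `β`,
where `(∇_W ψ)Z = ∇_W(ψZ) - ψ(∇_W Z)` and `Z` runs over the local smooth vector fields. -/
def AlmostContactMetric.IsTransSasakian (S : AlmostContactMetric F B) (α β : B → ℝ) : Prop :=
  ContMDiff 𝓘(ℝ, F) 𝓘(ℝ, ℝ) ∞ α ∧ ContMDiff 𝓘(ℝ, F) 𝓘(ℝ, ℝ) ∞ β ∧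
  ∀ (U : Set B) (Z : ∀ b : B, TangentSpace 𝓘(ℝ, F) b), IsOpen U → SmoothFieldOn Z U →
    ∀ b ∈ U, ∀ w : TangentSpace 𝓘(ℝ, F) b,
      leviCivita (fun x ↦ S.ψ x (Z x)) b w - S.ψ b (leviCivita Z b w) =
        α b • ((inner ℝ w (Z b) : ℝ) • S.ξ b - S.η b (Z b) • w) +
        β b • ((inner ℝ (S.ψ b w) (Z b) : ℝ) • S.ξ b - S.η b (Z b) • S.ψ b w)

end TransSasakian

/-! ## Riemannian maps and the Clairaut condition -/

section RiemannianMaps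

variable {E : Type*} [NormedAddCommGroup E] [NormedSpace ℝ E] [FiniteDimensional ℝ E]
  {M : Type*} [TopologicalSpace M] [ChartedSpace E M] [IsManifold 𝓘(ℝ, E) ∞ M]
  [RiemannianBundle (fun x : M ↦ TangentSpace 𝓘(ℝ, E) x)]
  {F : Type*} [NormedAddCommGroup F] [NormedSpace ℝ F] [FiniteDimensional ℝ F]
  {B : Type*} [TopologicalSpace B] [ChartedSpace F B] [IsManifold 𝓘(ℝ, F) ∞ B]
  [RiemannianBundle (fun x : B ↦ TangentSpace 𝓘(ℝ, F) x)]

/-- The differential `f_* : T_p M → T_{f p} B`. -/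
def pushforward (f : M → B) (p : M) :
    TangentSpace 𝓘(ℝ, E) p →L[ℝ] TangentSpace 𝓘(ℝ, F) (f p) :=
  mfderiv 𝓘(ℝ, E) 𝓘(ℝ, F) f p

/-- The subspace `range f_{*p}` of `T_{f p} B`. -/
def rangeAt (f : M → B) (p : M) : Submodule ℝ (TangentSpace 𝓘(ℝ, F) (f p)) :=
  (pushforward (E := E) (F := F) f p).toLinearMap.range

/-- The horizontal space `(ker f_{*p})^⊥` of `T_p M`. -/
def horizontalAt (f : M → B) (p : M) : Submodule ℝ (TangentSpace 𝓘(ℝ, E) p) :=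
  (pushforward (E := E) (F := F) f p).toLinearMap.kerᗮ

/-- A smooth map is a Riemannian map if `f_*` is isometric on the horizontal spaces. -/
def IsRiemannianMap (f : M → B) : Prop :=
  ContMDiff 𝓘(ℝ, E) 𝓘(ℝ, F) ∞ f ∧
  ∀ p, ∀ w ∈ horizontalAt (E := E) (F := F) f p, ∀ z ∈ horizontalAt (E := E) (F := F) f p,
    inner ℝ (pushforward (E := E) (F := F) f p w) (pushforward (E := E) (F := F) f p z) =
      (inner ℝ w z : ℝ)

/-- `ψ (range f_{*p}) ⊆ (range f_{*p})^⊥` for all `p`. -/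
def IsAntiInvariant (S : AlmostContactMetric F B) (f : M → B) : Prop :=
  ∀ p, ∀ v ∈ rangeAt (E := E) (F := F) f p, S.ψ (f p) v ∈ (rangeAt (E := E) (F := F) f p)ᗮ

/-- The Reeb vector field is horizontal: `ξ ∈ (range f_{*p})^⊥` for all `p`. -/
def HasHorizontalReeb (S : AlmostContactMetric F B) (f : M → B) : Prop :=
  ∀ p, S.ξ (f p) ∈ (rangeAt (E := E) (F := F) f p)ᗮ

/-- The second fundamental form `(∇f_*)(w, z) = ∇^f_w (f_* Z) - f_* (∇_w Z)` at `p`. It is tensorial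
in `Z`; here `Z` is Mathlib's standard local extension of `z` to a vector field smooth near `p`. -/
def secondFundamentalForm (f : M → B) (p : M) (w z : TangentSpace 𝓘(ℝ, E) p) :
    TangentSpace 𝓘(ℝ, F) (f p) :=
  covDerivAlong f (fun q ↦ pushforward (E := E) (F := F) f q (FiberBundle.extend E z q)) p w -
    pushforward (E := E) (F := F) f p (leviCivita (FiberBundle.extend E z) p w)

/-- `D` is a smooth distribution on the open set `U`: near every point of `U` it is spanned by
linearly independent smooth vector fields. -/
def IsSmoothDistributionOn (D : ∀ b : B, Submodule ℝ (TangentSpace 𝓘(ℝ, F) b)) (U : Set B) :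
    Prop :=
  ∀ b ∈ U, ∃ O : Set B, IsOpen O ∧ b ∈ O ∧
    ∃ (k : ℕ) (X : Fin k → ∀ x : B, TangentSpace 𝓘(ℝ, F) x),
      (∀ i, SmoothFieldOn (X i) O) ∧
      ∀ x ∈ O, LinearIndependent ℝ (fun i ↦ X i x) ∧ Submodule.span ℝ (range fun i ↦ X i x) = D x

/-- Clairaut condition with girth function `r`, in terms of geodesics. The subspaces `range f_*`
extend to a smooth distribution `D` on an open set `U` that contains the image of `f`, and for every
geodesic `Ω` in `U`, with components `X ∈ D` and `V ∈ D^⊥` of its velocity, `(r ∘ Ω) sin θ` is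
constant, where `θ` is the angle between the velocity and `V`
(Mathlib's angle with a zero vector is `π / 2`, which is the right value when `V = 0`). -/
def IsClairautMap (f : M → B) (r : B → ℝ) : Prop :=
  (∀ b, 0 < r b) ∧
  ∃ (U : Set B) (D : ∀ b : B, Submodule ℝ (TangentSpace 𝓘(ℝ, F) b)),
    IsOpen U ∧ (∀ p, f p ∈ U) ∧ IsSmoothDistributionOn D U ∧
    (∀ p, D (f p) = rangeAt (E := E) (F := F) f p) ∧
    ∀ (Ω : ℝ → B) (J : Set ℝ), IsOpen J → J.OrdConnected → MapsTo Ω J U →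
      IsGeodesicOn (F := F) Ω J →
      ∃ C : ℝ, ∀ s ∈ J, ∀ X ∈ D (Ω s), ∀ V ∈ (D (Ω s))ᗮ, velocity (F := F) Ω s = X + V →
        r (Ω s) * Real.sin (InnerProductGeometry.angle (velocity (F := F) Ω s) V) = C

/-- Clairaut condition with `r = e^h`, in terms of the second fundamental form: `f` is umbilical with
mean curvature vector `H = -∇h`, that is `(∇f_*)(w, z) = -g₁(w, z) ∇h` for horizontal `w`, `z`. The
gradient is expressed by `g₂(∇h, v) = dh(v)`. -/
def IsClairautUmbilical (f : M → B) (h : B → ℝ) : Prop :=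
  ∀ p, ∀ w ∈ horizontalAt (E := E) (F := F) f p, ∀ z ∈ horizontalAt (E := E) (F := F) f p,
    ∀ v : TangentSpace 𝓘(ℝ, F) (f p),
      inner ℝ (secondFundamentalForm (E := E) (F := F) f p w z) v =
        -(inner ℝ w z * mvfderiv 𝓘(ℝ, F) h (f p) v)

/-- `h` is constant along `ψ (range f_{*p})`: `dh` vanishes on this subspace of `T_{f p} B`. -/
def IsConstantAlongAt (S : AlmostContactMetric F B) (f : M → B) (h : B → ℝ) (p : M) : Prop :=
  ∀ v ∈ rangeAt (E := E) (F := F) f p, mvfderiv 𝓘(ℝ, F) h (f p) (S.ψ (f p) v) = 0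

end RiemannianMaps

end

/-!
Write `∇^f_w (f_* z)` for the pullback of the Levi-Civita connection applied to the differential of
`f`; it is symmetric in `w` and `z`. Differentiating `⟪ψ f_* z, f_* z'⟫ = 0` in the direction `w`,
the term from the trans-Sasakian identity vanishes because `ξ` is normal to the range of `f_*`, so
`⟪∇^f_w (f_* z), ψ f_* z'⟫` is symmetric in `z` and `z'`.

Either Clairaut condition gives `⟪∇^f_w (f_* z), u⟫ = -⟪w, z⟫ dh(u)` for `u` normal to the range of
`f_*`, where `⟪w, z⟫` is computed in `B` or on the horizontal space. For geodesics, differentiate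
Clairaut's relation at time `0` along the geodesic with initial velocity `W + u`, `W` a field in the
distribution, keep the part that is odd in `u`, and polarise in `W`.

With `φ = dh ∘ ψ ∘ f_*` this reads `⟪w, z⟫ φ(x) = ⟪w, x⟫ φ(z)`. If `φ(x) ≠ 0`, then `⟪w, w⟫ = 0` for
all `w` in the kernel of `φ`, so the range of `f_*` has dimension one. Finally, the rank of a
Riemannian map is locally constant: it is the trace of the projection `g₁⁻¹ (f^* g₂)` onto the
horizontal spaces, which depends continuously on the point.
-/

set_option maxSynthPendingDepth 3

noncomputable section

/-! ## Metrics on a vector space -/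

section LocalMetric

variable {F : Type*} [NormedAddCommGroup F] [NormedSpace ℝ F]
  {G : F → F →L[ℝ] F →L[ℝ] ℝ} {y : F}

/-- `G` is a Riemannian metric of class `C²` on a neighbourhood of `y` in a vector space. Positivity
is only recorded at `y` itself, which is all that calculus at `y` needs. -/
structure IsMetricAt (G : F → F →L[ℝ] F →L[ℝ] ℝ) (y : F) : Prop where
  contDiffAt : ContDiffAt ℝ 2 G y
  eventually_symm : ∀ᶠ z in 𝓝 y, ∀ v w, G z v w = G z w v
  pos : ∀ v, v ≠ 0 → 0 < G y v v

/-- The Christoffel symbols of the first kind of the metric `G`, as a trilinear form. -/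
def koszulForm (G : F → F →L[ℝ] F →L[ℝ] ℝ) (y : F) : F →L[ℝ] F →L[ℝ] F →L[ℝ] ℝ :=
  (2⁻¹ : ℝ) • (fderiv ℝ G y + (fderiv ℝ G y).flip -
    (ContinuousLinearMap.flipₗᵢ ℝ F F ℝ : _ →L[ℝ] _) ∘L (fderiv ℝ G y).flip)

/-- The Christoffel symbols of the second kind of the metric `G`, as a bilinear map. -/
def localChristoffel (G : F → F →L[ℝ] F →L[ℝ] ℝ) (y : F) : F →L[ℝ] F →L[ℝ] F :=
  ContinuousLinearMap.compL ℝ F (F →L[ℝ] ℝ) F (G y).inverse ∘L koszulForm G y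

lemma koszulForm_apply (G : F → F →L[ℝ] F →L[ℝ] ℝ) (y u v w : F) :
    koszulForm G y u v w =
      (fderiv ℝ G y u v w + fderiv ℝ G y v u w - fderiv ℝ G y w u v) / 2 := by
  change (2⁻¹ : ℝ) * (fderiv ℝ G y u v w + fderiv ℝ G y v u w - fderiv ℝ G y w u v) = _
  ring

namespace IsMetricAt

lemma differentiableAt (hG : IsMetricAt G y) : DifferentiableAt ℝ G y :=
  hG.contDiffAt.differentiableAt two_ne_zero

lemma symm (hG : IsMetricAt G y) (v w : F) : G y v w = G y w v :=
  hG.eventually_symm.self_of_nhds v w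

lemma fderiv_symm (hG : IsMetricAt G y) (a v w : F) :
    fderiv ℝ G y a v w = fderiv ℝ G y a w v := by
  have hflip : G =ᶠ[𝓝 y] fun z ↦ ContinuousLinearMap.flipₗᵢ ℝ F F ℝ (G z) :=
    hG.eventually_symm.mono fun z hz ↦ by ext v w; exact hz v w
  have hd := ((ContinuousLinearMap.flipₗᵢ ℝ F F ℝ).toContinuousLinearEquiv.hasFDerivAt.comp y
    hG.differentiableAt.hasFDerivAt).congr_of_eventuallyEq hflip
  exact DFunLike.congr_fun (DFunLike.congr_fun
    (DFunLike.congr_fun (hG.differentiableAt.hasFDerivAt.unique hd) a) v) w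

lemma eq_of_forall (hG : IsMetricAt G y) {u v : F} (h : ∀ w, G y u w = G y v w) : u = v := by
  by_contra hne
  have hpos := hG.pos (u - v) (sub_ne_zero.2 hne)
  rw [map_sub (G y) u v, _root_.sub_apply, h, sub_self] at hpos
  exact hpos.false

variable [FiniteDimensional ℝ F]

lemma isInvertible (hG : IsMetricAt G y) : (G y).IsInvertible := by
  have hinj : Function.Injective (G y).toLinearMap := fun u v huv ↦
    hG.eq_of_forall (DFunLike.congr_fun huv)
  have hdim : Module.finrank ℝ F = Module.finrank ℝ (F →L[ℝ] ℝ) := by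
    rw [← LinearMap.toContinuousLinearMap.finrank_eq (R := ℝ)]
    exact Subspace.dual_finrank_eq.symm
  exact ⟨(LinearEquiv.ofInjectiveOfFinrankEq _ hinj hdim).toContinuousLinearEquiv, rfl⟩

lemma apply_localChristoffel (hG : IsMetricAt G y) (u v w : F) :
    G y (localChristoffel G y u v) w = koszulForm G y u v w :=
  DFunLike.congr_fun (hG.isInvertible.self_apply_inverse (koszulForm G y u v)) w

lemma localChristoffel_comm (hG : IsMetricAt G y) (u v : F) :
    localChristoffel G y u v = localChristoffel G y v u := by
  refine hG.eq_of_forall fun w ↦ ?_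
  rw [hG.apply_localChristoffel, hG.apply_localChristoffel, koszulForm_apply, koszulForm_apply,
    hG.fderiv_symm w u v]
  ring

lemma fderiv_eq (hG : IsMetricAt G y) (a u v : F) :
    fderiv ℝ G y a u v = G y (localChristoffel G y a u) v + G y u (localChristoffel G y a v) := by
  rw [hG.symm u, hG.apply_localChristoffel, hG.apply_localChristoffel, koszulForm_apply,
    koszulForm_apply, hG.fderiv_symm a v u]
  ring

lemma contDiffAt_localChristoffel (hG : IsMetricAt G y) :
    ContDiffAt ℝ 1 (localChristoffel G) y := by
  have hD : ContDiffAt ℝ 1 (fderiv ℝ G) y := hG.contDiffAt.fderiv_right one_add_one_eq_two.le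
  have hflip : ContDiffAt ℝ 1 (fun z ↦ (fderiv ℝ G z).flip) y :=
    (ContinuousLinearMap.flipₗᵢ ℝ F F (F →L[ℝ] ℝ)).contDiff.contDiffAt.comp y hD
  have hinv : ContDiffAt ℝ 1 (fun z ↦ (G z).inverse) y :=
    hG.isInvertible.contDiffAt_map_inverse.comp y (hG.contDiffAt.of_le one_le_two)
  have hkoszul : ContDiffAt ℝ 1 (koszulForm G) y :=
    ((hD.add hflip).sub (contDiffAt_const.clm_comp hflip)).const_smul (2⁻¹ : ℝ)
  exact ((ContinuousLinearMap.compL ℝ F (F →L[ℝ] ℝ) F).contDiff.contDiffAt.comp y hinv).clm_comp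
    hkoszul

end IsMetricAt

end LocalMetric

section LocalConnection

variable {E : Type*} [NormedAddCommGroup E] [NormedSpace ℝ E]
  {F : Type*} [NormedAddCommGroup F] [NormedSpace ℝ F]
  {G : F → F →L[ℝ] F →L[ℝ] ℝ} {f : E → F} {V W : E → F} {x : E}

/-- The covariant derivative `∇_w V` at `x` of a vector field `V` along `f : E → F`, for the
Levi-Civita connection of the metric `G` on `F`, as a linear map in `w`. -/
def localCovDeriv (G : F → F →L[ℝ] F →L[ℝ] ℝ) (f : E → F) (V : E → F) (x : E) : E →L[ℝ] F :=
  fderiv ℝ V x + (localChristoffel G (f x)).flip (V x) ∘L fderiv ℝ f x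

/-- The covariant derivative `(∇_a Ψ) v` at `y` of a field of endomorphisms `Ψ` of `F`, for the
Levi-Civita connection of `G`. -/
def localCovDerivEnd (G : F → F →L[ℝ] F →L[ℝ] ℝ) (Ψ : F → F →L[ℝ] F) (y a v : F) : F :=
  fderiv ℝ Ψ y a v + localChristoffel G y a (Ψ y v) - Ψ y (localChristoffel G y a v)

/-- The Hessian `(∇f_*)(w, z)` of a map from a flat space into a space with metric `G`. -/
def localHessian (G : F → F →L[ℝ] F →L[ℝ] ℝ) (f : E → F) (x w z : E) : F :=
  localCovDeriv G f (fun x' ↦ fderiv ℝ f x' z) x w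

lemma localCovDeriv_apply (G : F → F →L[ℝ] F →L[ℝ] ℝ) (f V : E → F) (x w : E) :
    localCovDeriv G f V x w =
      fderiv ℝ V x w + localChristoffel G (f x) (fderiv ℝ f x w) (V x) :=
  rfl

lemma localCovDeriv_comp {X : F → F} (hX : DifferentiableAt ℝ X (f x))
    (hf : DifferentiableAt ℝ f x) (w : E) :
    localCovDeriv G f (X ∘ f) x w = localCovDeriv G id X (f x) (fderiv ℝ f x w) := by
  rw [localCovDeriv_apply, localCovDeriv_apply, fderiv_comp x hX hf, fderiv_id]
  rfl

lemma localCovDeriv_clm_apply {Ψ : F → F →L[ℝ] F} (hΨ : DifferentiableAt ℝ Ψ (f x))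
    (hf : DifferentiableAt ℝ f x) (hV : DifferentiableAt ℝ V x) (w : E) :
    localCovDeriv G f (fun x' ↦ Ψ (f x') (V x')) x w =
      localCovDerivEnd G Ψ (f x) (fderiv ℝ f x w) (V x) + Ψ (f x) (localCovDeriv G f V x w) := by
  have hd := ((hΨ.hasFDerivAt.comp x hf.hasFDerivAt).clm_apply hV.hasFDerivAt).fderiv
  simp only [localCovDeriv_apply, localCovDerivEnd, map_add]
  rw [show fderiv ℝ (fun x' ↦ Ψ (f x') (V x')) x w = Ψ (f x) (fderiv ℝ V x w) +
    fderiv ℝ Ψ (f x) (fderiv ℝ f x w) (V x) from DFunLike.congr_fun hd w]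
  abel

lemma fderiv_fderiv_apply (hf : DifferentiableAt ℝ (fderiv ℝ f) x) (w z : E) :
    fderiv ℝ (fun x' ↦ fderiv ℝ f x' z) x w = fderiv ℝ (fderiv ℝ f) x w z := by
  rw [fderiv_clm_apply hf (differentiableAt_const z)]
  simp

variable [FiniteDimensional ℝ F]

lemma fderiv_metric_apply (hG : IsMetricAt G (f x)) (hf : DifferentiableAt ℝ f x)
    (hV : DifferentiableAt ℝ V x) (hW : DifferentiableAt ℝ W x) (w : E) :
    fderiv ℝ (fun x' ↦ G (f x') (V x') (W x')) x w =
      G (f x) (localCovDeriv G f V x w) (W x) + G (f x) (V x) (localCovDeriv G f W x w) := by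
  have hd := (((hG.differentiableAt.hasFDerivAt.comp x hf.hasFDerivAt).clm_apply
    hV.hasFDerivAt).clm_apply hW.hasFDerivAt).fderiv
  calc fderiv ℝ (fun x' ↦ G (f x') (V x') (W x')) x w
      = G (f x) (V x) (fderiv ℝ W x w) + (G (f x) (fderiv ℝ V x w) (W x) +
          fderiv ℝ G (f x) (fderiv ℝ f x w) (V x) (W x)) := DFunLike.congr_fun hd w
    _ = _ := by
      rw [hG.fderiv_eq, localCovDeriv_apply, localCovDeriv_apply, map_add, map_add,
        _root_.add_apply]
      ring

lemma localHessian_comm (hG : IsMetricAt G (f x)) (hf : ContDiffAt ℝ 2 f x) (w z : E) :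
    localHessian G f x w z = localHessian G f x z w := by
  have hd : DifferentiableAt ℝ (fderiv ℝ f) x :=
    (hf.fderiv_right one_add_one_eq_two.le).differentiableAt one_ne_zero
  rw [localHessian, localHessian, localCovDeriv_apply, localCovDeriv_apply, fderiv_fderiv_apply hd,
    fderiv_fderiv_apply hd, hG.localChristoffel_comm,
    (hf.isSymmSndFDerivAt (by simp)).eq w z]

lemma metric_localHessian_comm_of_antiInvariant (hG : IsMetricAt G (f x))
    (hf : ContDiffAt ℝ 2 f x) {Ψ : F → F →L[ℝ] F} (hΨ : DifferentiableAt ℝ Ψ (f x))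
    (hskew : ∀ u v, G (f x) (Ψ (f x) u) v = -G (f x) u (Ψ (f x) v))
    (hanti : ∀ᶠ x' in 𝓝 x, ∀ z z',
      G (f x') (Ψ (f x') (fderiv ℝ f x' z)) (fderiv ℝ f x' z') = 0)
    (hcov : ∀ w z z', G (f x)
      (localCovDerivEnd G Ψ (f x) (fderiv ℝ f x w) (fderiv ℝ f x z)) (fderiv ℝ f x z') = 0)
    (w z z' : E) :
    G (f x) (localHessian G f x w z) (Ψ (f x) (fderiv ℝ f x z')) =
      G (f x) (localHessian G f x w z') (Ψ (f x) (fderiv ℝ f x z)) := by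
  have hf1 : DifferentiableAt ℝ f x := hf.differentiableAt two_ne_zero
  have hd (z : E) : DifferentiableAt ℝ (fun x' ↦ fderiv ℝ f x' z) x :=
    ((hf.fderiv_right one_add_one_eq_two.le).differentiableAt one_ne_zero).clm_apply
      (differentiableAt_const z)
  have hleibniz := calc
    0 = fderiv ℝ (fun x' ↦ G (f x') (Ψ (f x') (fderiv ℝ f x' z)) (fderiv ℝ f x' z')) x w := by
      rw [EventuallyEq.fderiv_eq (hanti.mono fun x' hx' ↦ hx' z z'), fderiv_const_apply,
        _root_.zero_apply]
    _ = G (f x) (localCovDeriv G f (fun x' ↦ Ψ (f x') (fderiv ℝ f x' z)) x w) (fderiv ℝ f x z') +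
          G (f x) (Ψ (f x) (fderiv ℝ f x z)) (localHessian G f x w z') :=
      fderiv_metric_apply hG hf1 ((hΨ.comp x hf1).clm_apply (hd z)) (hd z') w
    _ = G (f x) (Ψ (f x) (localHessian G f x w z)) (fderiv ℝ f x z') +
          G (f x) (Ψ (f x) (fderiv ℝ f x z)) (localHessian G f x w z') := by
      rw [localCovDeriv_clm_apply hΨ hf1 (hd z), map_add, _root_.add_apply, hcov, zero_add]
      rfl
  rw [hskew, hG.symm (Ψ (f x) _)] at hleibniz
  linarith

end LocalConnection

/-! ## Geodesics and Clairaut's relation on a vector space -/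

section LocalGeodesics

variable {F : Type*} [NormedAddCommGroup F] [NormedSpace ℝ F]
  {G : F → F →L[ℝ] F →L[ℝ] ℝ} {γ σ : ℝ → F} {J : Set ℝ} {y : F}

/-- `γ` is a geodesic of the metric `G` on `J`, with velocity `σ`: the geodesic equation as a first
order system. -/
def IsLocalGeodesicOn (G : F → F →L[ℝ] F →L[ℝ] ℝ) (γ σ : ℝ → F) (J : Set ℝ) : Prop :=
  ∀ s ∈ J, HasDerivAt γ (σ s) s ∧ HasDerivAt σ (-localChristoffel G (γ s) (σ s) (σ s)) s

lemma IsLocalGeodesicOn.fderiv_apply_one (hγ : IsLocalGeodesicOn G γ σ J) {s : ℝ} (hs : s ∈ J) :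
    fderiv ℝ γ s 1 = σ s := by
  rw [fderiv_apply_one_eq_deriv, (hγ s hs).1.deriv]

lemma IsLocalGeodesicOn.localCovDeriv_eq_zero (hγ : IsLocalGeodesicOn G γ σ J) {s : ℝ}
    (hs : s ∈ J) : localCovDeriv G γ σ s 1 = 0 := by
  rw [localCovDeriv_apply, hγ.fderiv_apply_one hs, fderiv_apply_one_eq_deriv, (hγ s hs).2.deriv,
    neg_add_cancel]

variable [FiniteDimensional ℝ F]

lemma exists_isLocalGeodesicOn (hG : IsMetricAt G y) {O : Set F} (hO : O ∈ 𝓝 y) (v : F) :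
    ∃ ε > 0, ∃ γ σ : ℝ → F, γ 0 = y ∧ σ 0 = v ∧ MapsTo γ (Ioo (-ε) ε) O ∧
      IsLocalGeodesicOn G γ σ (Ioo (-ε) ε) := by
  have hΓ : ContDiffAt ℝ 1 (fun q : F × F ↦ localChristoffel G q.1) (y, v) :=
    ContDiffAt.comp (g := localChristoffel G) (y, v) hG.contDiffAt_localChristoffel contDiffAt_fst
  have hspray : ContDiffAt ℝ 1 (fun q : F × F ↦ (q.2, -localChristoffel G q.1 q.2 q.2)) (y, v) :=
    contDiffAt_snd.prodMk ((hΓ.clm_apply contDiffAt_snd).clm_apply contDiffAt_snd).neg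
  obtain ⟨α, hα0, ε, hε, hα⟩ :=
    hspray.exists_forall_mem_closedBall_exists_eq_forall_mem_Ioo_hasDerivAt₀ 0
  rw [zero_sub, zero_add] at hα
  have hcont : ContinuousAt (fun s ↦ (α s).1) 0 :=
    continuousAt_fst.comp (hα 0 ⟨neg_lt_zero.2 hε, hε⟩).continuousAt
  obtain ⟨δ, hδ, hball⟩ :=
    Metric.eventually_nhds_iff.1 (hcont.eventually_mem (by rwa [hα0] : O ∈ 𝓝 (α 0).1))
  refine ⟨min ε δ, lt_min hε hδ, fun s ↦ (α s).1, fun s ↦ (α s).2,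
    congrArg Prod.fst hα0, congrArg Prod.snd hα0, fun s hs ↦ hball ?_, fun s hs ↦ ?_⟩
  · rw [Real.dist_0_eq_abs]
    exact (abs_lt.2 hs).trans_le (min_le_right ε δ)
  · have hd := hα s (abs_lt.1 ((abs_lt.2 hs).trans_le (min_le_left ε δ)))
    exact ⟨(hasFDerivAt_fst (𝕜 := ℝ) (p := α s)).comp_hasDerivAt s hd,
      (hasFDerivAt_snd (𝕜 := ℝ) (p := α s)).comp_hasDerivAt s hd⟩

lemma hasDerivAt_metric_apply {V W : ℝ → F} {s : ℝ} (hG : IsMetricAt G (γ s))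
    (hγ : DifferentiableAt ℝ γ s) (hV : DifferentiableAt ℝ V s) (hW : DifferentiableAt ℝ W s) :
    HasDerivAt (fun t ↦ G (γ t) (V t) (W t))
      (G (γ s) (localCovDeriv G γ V s 1) (W s) + G (γ s) (V s) (localCovDeriv G γ W s 1)) s := by
  rw [← fderiv_metric_apply hG hγ hV hW, fderiv_apply_one_eq_deriv]
  exact (((hG.differentiableAt.comp s hγ).clm_apply hV).clm_apply hW).hasDerivAt

end LocalGeodesics

section LocalClairaut

variable {E : Type*} [NormedAddCommGroup E] [NormedSpace ℝ E]
  {F : Type*} [NormedAddCommGroup F] [NormedSpace ℝ F]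
  {A : Type*} [NormedAddCommGroup A] [NormedSpace ℝ A]
  {G : F → F →L[ℝ] F →L[ℝ] ℝ} {T : F → A →L[ℝ] F} {h : F → ℝ} {O : Set F} {y u : F}

/-- Clairaut's relation for the distribution `range T` of a vector space with metric `G`: along
every geodesic in `O`, the squared length of the component of the velocity in `range T` is `e^{-2h}`
times that of the velocity, up to a constant factor `K`. The squared length of the component of `v`
in a subspace `D` is written as `max_{x ∈ D} (2 ⟨x, v⟩ - ⟨x, x⟩)`, so that no projection occurs. -/
def IsLocalClairautOn (G : F → F →L[ℝ] F →L[ℝ] ℝ) (T : F → A →L[ℝ] F) (h : F → ℝ) (O : Set F) :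
    Prop :=
  ∀ (γ σ : ℝ → F) (J : Set ℝ), IsOpen J → J.OrdConnected → MapsTo γ J O →
    IsLocalGeodesicOn G γ σ J →
    ∃ K : ℝ, ∀ s ∈ J, IsGreatest
      (range fun a ↦ 2 * G (γ s) (T (γ s) a) (σ s) - G (γ s) (T (γ s) a) (T (γ s) a))
      (K * Real.exp (-2 * h (γ s)) * G (γ s) (σ s) (σ s))

lemma IsMetricAt.isGreatest_range_clm (hG : IsMetricAt G y) {L : A →L[ℝ] F} (a : A)
    (hu : ∀ b, G y (L b) u = 0) :
    IsGreatest (range fun b ↦ 2 * G y (L b) (L a + u) - G y (L b) (L b)) (G y (L a) (L a)) := by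
  refine ⟨⟨a, by simp only [map_add, hu]; ring⟩, ?_⟩
  rintro _ ⟨b, rfl⟩
  have hnonneg : 0 ≤ G y (L b - L a) (L b - L a) := by
    rcases eq_or_ne (L b - L a) 0 with hba | hba
    · simp [hba]
    · exact (hG.pos _ hba).le
  simp only [map_sub, _root_.sub_apply, hG.symm (L a) (L b)] at hnonneg
  simp only [map_add, hu]
  linarith

variable [FiniteDimensional ℝ F]

lemma metric_localCovDeriv_eq_of_isLocalMin {γ σ : ℝ → F} {J : Set ℝ} {X : F → F} {K : ℝ}
    (hG : IsMetricAt G (γ 0)) (hγ : IsLocalGeodesicOn G γ σ J) (h0 : 0 ∈ J)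
    (hX : DifferentiableAt ℝ X (γ 0)) (hh : DifferentiableAt ℝ h (γ 0))
    (hmin : IsLocalMin (fun s ↦ K * Real.exp (-2 * h (γ s)) * G (γ s) (σ s) (σ s) -
      (2 * G (γ s) (X (γ s)) (σ s) - G (γ s) (X (γ s)) (X (γ s)))) 0)
    (hK : K * Real.exp (-2 * h (γ 0)) * G (γ 0) (σ 0) (σ 0) = G (γ 0) (X (γ 0)) (X (γ 0))) :
    G (γ 0) (localCovDeriv G id X (γ 0) (σ 0)) (σ 0 - X (γ 0)) =
      -(G (γ 0) (X (γ 0)) (X (γ 0)) * fderiv ℝ h (γ 0) (σ 0)) := by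
  have dγ := (hγ 0 h0).1.differentiableAt
  have dσ := (hγ 0 h0).2.differentiableAt
  have dX : DifferentiableAt ℝ (fun s ↦ X (γ s)) 0 := hX.comp 0 dγ
  have hXγ : localCovDeriv G γ (fun s ↦ X (γ s)) 0 1 = localCovDeriv G id X (γ 0) (σ 0) := by
    rw [← hγ.fderiv_apply_one h0]
    exact localCovDeriv_comp hX dγ 1
  have dh : HasDerivAt (h ∘ γ) (fderiv ℝ h (γ 0) (σ 0)) 0 :=
    hh.hasFDerivAt.comp_hasDerivAt 0 (hγ 0 h0).1
  have hzero := hmin.hasDerivAt_eq_zero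
    ((((dh.const_mul (-2)).exp.const_mul K).mul (hasDerivAt_metric_apply hG dγ dσ dσ)).sub
      (((hasDerivAt_metric_apply hG dγ dX dσ).const_mul 2).sub
        (hasDerivAt_metric_apply hG dγ dX dX)))
  rw [hγ.localCovDeriv_eq_zero h0, hXγ, hG.symm (X (γ 0)) (localCovDeriv G id X (γ 0) (σ 0))]
    at hzero
  simp only [Function.comp_apply, map_zero, _root_.zero_apply, add_zero, mul_zero] at hzero
  rw [map_sub]
  linear_combination (-1 / 2 : ℝ) * hzero - fderiv ℝ h (γ 0) (σ 0) * hK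

lemma IsLocalClairautOn.metric_localCovDeriv_add (hC : IsLocalClairautOn G T h O)
    (hG : IsMetricAt G y) (hO : O ∈ 𝓝 y) (hT : DifferentiableAt ℝ T y)
    (hh : DifferentiableAt ℝ h y) (hu : ∀ b, G y (T y b) u = 0) (a : A) :
    G y (localCovDeriv G id (fun z ↦ T z a) y (T y a + u)) u =
      -(G y (T y a) (T y a) * fderiv ℝ h y (T y a + u)) := by
  obtain ⟨ε, hε, γ, σ, rfl, hσ0, hγO, hγ⟩ := exists_isLocalGeodesicOn hG hO (T y a + u)
  have h0 : (0 : ℝ) ∈ Ioo (-ε) ε := ⟨neg_lt_zero.2 hε, hε⟩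
  obtain ⟨K, hK⟩ := hC γ σ _ isOpen_Ioo ordConnected_Ioo hγO hγ
  have hK0 := (hσ0 ▸ hK 0 h0).unique (hG.isGreatest_range_clm a hu)
  have hmin : IsLocalMin (fun s ↦ K * Real.exp (-2 * h (γ s)) * G (γ s) (σ s) (σ s) -
      (2 * G (γ s) (T (γ s) a) (σ s) - G (γ s) (T (γ s) a) (T (γ s) a))) 0 := by
    filter_upwards [isOpen_Ioo.mem_nhds h0] with s hs
    have hle := (hK s hs).2 ⟨a, rfl⟩
    have heq : K * Real.exp (-2 * h (γ 0)) * G (γ 0) (σ 0) (σ 0) -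
        (2 * G (γ 0) (T (γ 0) a) (σ 0) - G (γ 0) (T (γ 0) a) (T (γ 0) a)) = 0 := by
      rw [hσ0, hK0, map_add, hu]
      ring
    rw [heq]
    exact sub_nonneg.2 hle
  have hvar := metric_localCovDeriv_eq_of_isLocalMin hG hγ h0
    (hT.clm_apply (differentiableAt_const a)) hh hmin (by rw [hσ0, hK0])
  rwa [hσ0, add_sub_cancel_left] at hvar

lemma IsLocalClairautOn.metric_localCovDeriv (hC : IsLocalClairautOn G T h O)
    (hG : IsMetricAt G y) (hO : O ∈ 𝓝 y) (hT : DifferentiableAt ℝ T y)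
    (hh : DifferentiableAt ℝ h y) (hu : ∀ b, G y (T y b) u = 0) (a : A) :
    G y (localCovDeriv G id (fun z ↦ T z a) y (T y a)) u =
      -(G y (T y a) (T y a) * fderiv ℝ h y u) := by
  -- The relation for `u` minus the relation for `-u`.
  have hpos := hC.metric_localCovDeriv_add hG hO hT hh hu a
  have hneg := hC.metric_localCovDeriv_add hG hO hT hh (u := -u)
    (fun b ↦ by rw [map_neg, hu, neg_zero]) a
  simp only [map_add, map_neg, _root_.add_apply, _root_.neg_apply] at hpos hneg
  linarith

lemma fderiv_mem_range_of_eventually_mem_range {T : E → A →L[ℝ] F} [FiniteDimensional ℝ A]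
    {Y : E → F} {x : E} (hT : DifferentiableAt ℝ T x) (hinj : Function.Injective (T x))
    (hY : DifferentiableAt ℝ Y x) (hmem : ∀ᶠ x' in 𝓝 x, Y x' ∈ range (T x')) (h0 : Y x = 0)
    (w : E) : fderiv ℝ Y x w ∈ range (T x) := by
  obtain ⟨L, hL⟩ : ∃ L : F →L[ℝ] A, L ∘L T x = .id ℝ A := by
    obtain ⟨L, hL⟩ := LinearMap.exists_leftInverse_of_injective (T x).toLinearMap
      (LinearMap.ker_eq_bot.2 hinj)
    exact ⟨L.toContinuousLinearMap, ContinuousLinearMap.ext (LinearMap.congr_fun hL)⟩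
  have hLT : DifferentiableAt ℝ (fun x' ↦ L ∘L T x') x := (differentiableAt_const L).clm_comp hT
  have hinvertible : ∀ᶠ x' in 𝓝 x, (L ∘L T x').IsInvertible := hLT.continuousAt.eventually <| by
    simp only [hL]
    exact (ContinuousLinearEquiv.refl ℝ A).nhds
  have hinv : DifferentiableAt ℝ (fun x' ↦ (L ∘L T x').inverse) x :=
    DifferentiableAt.comp (g := ContinuousLinearMap.inverse) x
      (hinvertible.self_of_nhds.contDiffAt_map_inverse.differentiableAt one_ne_zero) hLT
  let S : E → F →L[ℝ] F := fun x' ↦ T x' ∘L (L ∘L T x').inverse ∘L L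
  have hSY : Y =ᶠ[𝓝 x] fun x' ↦ S x' (Y x') := by
    filter_upwards [hmem, hinvertible] with x' ⟨a, ha⟩ hx'
    rw [← ha]
    exact congrArg (T x') (hx'.inverse_apply_self a).symm
  have hSd : DifferentiableAt ℝ S x := hT.clm_comp (hinv.clm_comp (differentiableAt_const L))
  refine ⟨(L ∘L T x).inverse (L (fderiv ℝ Y x w)), ?_⟩
  have hfderiv : fderiv ℝ Y x w = S x (fderiv ℝ Y x w) := by
    conv_lhs => rw [hSY.fderiv_eq, fderiv_clm_apply hSd hY]
    simp [h0]
  exact hfderiv.symm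

variable {f : E → F} {x : E}

lemma IsLocalClairautOn.metric_localHessian_self [FiniteDimensional ℝ A]
    (hC : IsLocalClairautOn G T h O) (hG : IsMetricAt G (f x)) (hO : O ∈ 𝓝 (f x))
    (hT : DifferentiableAt ℝ T (f x)) (hinj : Function.Injective (T (f x)))
    (hh : DifferentiableAt ℝ h (f x)) (hu : ∀ b, G (f x) (T (f x) b) u = 0)
    (hf : ContDiffAt ℝ 2 f x)
    (hmem : ∀ᶠ x' in 𝓝 x, ∀ w, fderiv ℝ f x' w ∈ range (T (f x'))) (w : E) :
    G (f x) (localHessian G f x w w) u =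
      -(G (f x) (fderiv ℝ f x w) (fderiv ℝ f x w) * fderiv ℝ h (f x) u) := by
  have hf1 : DifferentiableAt ℝ f x := hf.differentiableAt two_ne_zero
  have hfw : DifferentiableAt ℝ (fun x' ↦ fderiv ℝ f x' w) x :=
    ((hf.fderiv_right one_add_one_eq_two.le).differentiableAt one_ne_zero).clm_apply
      (differentiableAt_const w)
  obtain ⟨a, ha⟩ := hmem.self_of_nhds w
  have hX : DifferentiableAt ℝ (fun z ↦ T z a) (f x) := hT.clm_apply (differentiableAt_const a)
  have hXf : DifferentiableAt ℝ ((fun z ↦ T z a) ∘ f) x := hX.comp x hf1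
  obtain ⟨b, hb⟩ := fderiv_mem_range_of_eventually_mem_range
    (Y := fun x' ↦ fderiv ℝ f x' w - T (f x') a) (hT.comp x hf1) hinj (hfw.sub hXf)
    (hmem.mono fun x' hx' ↦ by
      obtain ⟨c, hc⟩ := hx' w
      exact ⟨c - a, by rw [← hc, map_sub]; rfl⟩) (sub_eq_zero.2 ha.symm) w
  have hHess : localHessian G f x w w =
      T (f x) b + localCovDeriv G id (fun z ↦ T z a) (f x) (T (f x) a) := by
    have hTb : T (f x) b =
        fderiv ℝ (fun x' ↦ fderiv ℝ f x' w) x w - fderiv ℝ ((fun z ↦ T z a) ∘ f) x w :=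
      hb.trans (DFunLike.congr_fun (fderiv_sub hfw hXf) w)
    rw [hTb, ha, ← localCovDeriv_comp hX hf1, localHessian, localCovDeriv_apply,
      localCovDeriv_apply, Function.comp_apply, ha]
    abel
  rw [hHess, map_add, _root_.add_apply, hu, zero_add, hC.metric_localCovDeriv hG hO hT hh hu a, ha]

lemma IsLocalClairautOn.metric_localHessian [FiniteDimensional ℝ A]
    (hC : IsLocalClairautOn G T h O) (hG : IsMetricAt G (f x)) (hO : O ∈ 𝓝 (f x))
    (hT : DifferentiableAt ℝ T (f x)) (hinj : Function.Injective (T (f x)))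
    (hh : DifferentiableAt ℝ h (f x)) (hu : ∀ b, G (f x) (T (f x) b) u = 0)
    (hf : ContDiffAt ℝ 2 f x)
    (hmem : ∀ᶠ x' in 𝓝 x, ∀ w, fderiv ℝ f x' w ∈ range (T (f x'))) (w z : E) :
    G (f x) (localHessian G f x w z) u =
      -(G (f x) (fderiv ℝ f x w) (fderiv ℝ f x z) * fderiv ℝ h (f x) u) := by
  have hself := hC.metric_localHessian_self hG hO hT hinj hh hu hf hmem
  have hadd (w w' z : E) :
      localHessian G f x (w + w') z = localHessian G f x w z + localHessian G f x w' z :=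
    map_add _ w w'
  have hsum := hself (w + z)
  rw [hadd, localHessian_comm hG hf w, localHessian_comm hG hf z, hadd, hadd,
    localHessian_comm hG hf z w] at hsum
  simp only [map_add, _root_.add_apply, hself w, hself z,
    hG.symm (fderiv ℝ f x z) (fderiv ℝ f x w)] at hsum
  linarith

end LocalClairaut

/-! ## Transfer to charts -/

section Charts

variable {F : Type*} [NormedAddCommGroup F] [NormedSpace ℝ F]
  {B : Type*} [TopologicalSpace B] [ChartedSpace F B] [IsManifold 𝓘(ℝ, F) ∞ B]
  {c x : B}

omit [IsManifold 𝓘(ℝ, F) ∞ B] in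
lemma symm_mem_chart_source {y : F} (hy : y ∈ (extChartAt 𝓘(ℝ, F) c).target) :
    (extChartAt 𝓘(ℝ, F) c).symm y ∈ (chartAt F c).source := by
  simpa using (extChartAt 𝓘(ℝ, F) c).map_target hy

lemma isInvertible_coordVec (hx : x ∈ (chartAt F c).source) :
    (coordVec (F := F) c x).IsInvertible := by
  rw [← extChartAt_source 𝓘(ℝ, F)] at hx
  exact isInvertible_mfderiv_extChartAt hx

lemma coordVec_ofCoordVec (hx : x ∈ (chartAt F c).source) (u : F) :
    coordVec c x (ofCoordVec c x u) = u :=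
  (isInvertible_coordVec hx).self_apply_inverse u

lemma ofCoordVec_coordVec (hx : x ∈ (chartAt F c).source) (v : TangentSpace 𝓘(ℝ, F) x) :
    ofCoordVec c x (coordVec c x v) = v :=
  (isInvertible_coordVec hx).inverse_apply_self v

lemma snd_trivializationAt (hx : x ∈ (chartAt F c).source) (v : TangentSpace 𝓘(ℝ, F) x) :
    (trivializationAt F (TangentSpace 𝓘(ℝ, F)) c ⟨x, v⟩).2 = coordVec c x v := by
  have hx' : x ∈ (trivializationAt F (TangentSpace 𝓘(ℝ, F)) c).baseSet := by simpa using hx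
  have hmap := TangentBundle.continuousLinearMapAt_trivializationAt (I := 𝓘(ℝ, F)) hx
  exact ((congrFun (Trivialization.coe_linearMapAt_of_mem (R := ℝ) _ hx') v).symm.trans
    (DFunLike.congr_fun hmap v) :)

lemma coordVec_extend (hx : x ∈ (chartAt F c).source) (v : TangentSpace 𝓘(ℝ, F) c) :
    coordVec c x (FiberBundle.extend F v x) = coordVec c c v := by
  have hx' : x ∈ (trivializationAt F (TangentSpace 𝓘(ℝ, F)) c).baseSet := by simpa using hx
  rw [← snd_trivializationAt hx, ← snd_trivializationAt (mem_chart_source F c)]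
  exact (congrArg Prod.snd (Trivialization.apply_mk_symm _ hx' _) :)

lemma smoothFieldOn_ofCoordVec (c : B) (u : F) :
    SmoothFieldOn (fun x ↦ ofCoordVec c x u) (chartAt F c).source := by
  have hb : (trivializationAt F (TangentSpace 𝓘(ℝ, F)) c).baseSet = (chartAt F c).source := by simp
  rw [SmoothFieldOn, ← hb, Trivialization.contMDiffOn_section_baseSet_iff]
  refine (contMDiffOn_const (c := u)).congr fun x hx ↦ ?_
  rw [snd_trivializationAt (hb ▸ hx), coordVec_ofCoordVec (hb ▸ hx)]

lemma contMDiffAt_extChartAt_symm {y : F} (hy : y ∈ (extChartAt 𝓘(ℝ, F) c).target) :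
    ContMDiffAt 𝓘(ℝ, F) 𝓘(ℝ, F) ∞ (extChartAt 𝓘(ℝ, F) c).symm y :=
  (contMDiffOn_extChartAt_symm c y hy).contMDiffAt ((isOpen_extChartAt_target c).mem_nhds hy)

lemma SmoothFieldOn.contDiffAt_coordVec {X : ∀ x : B, TangentSpace 𝓘(ℝ, F) x} {U : Set B}
    (hX : SmoothFieldOn X U) (hU : IsOpen U) {y : F} (hy : y ∈ (extChartAt 𝓘(ℝ, F) c).target)
    (hyU : (extChartAt 𝓘(ℝ, F) c).symm y ∈ U) :
    ContDiffAt ℝ ∞ (fun z ↦ coordVec c ((extChartAt 𝓘(ℝ, F) c).symm z)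
      (X ((extChartAt 𝓘(ℝ, F) c).symm z))) y := by
  have hX' := (hX _ hyU).contMDiffAt (hU.mem_nhds hyU)
  rw [(trivializationAt F (TangentSpace 𝓘(ℝ, F)) c).contMDiffAt_section_iff
    (by simpa using symm_mem_chart_source hy)] at hX'
  refine (hX'.comp y (contMDiffAt_extChartAt_symm hy)).contDiffAt.congr_of_eventuallyEq ?_
  filter_upwards [(isOpen_extChartAt_target c).mem_nhds hy] with z hz
  exact (snd_trivializationAt (symm_mem_chart_source hz) _).symm

end Charts

section ChartMetric

variable {F : Type*} [NormedAddCommGroup F] [NormedSpace ℝ F]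
  {B : Type*} [TopologicalSpace B] [ChartedSpace F B]
  [RiemannianBundle (fun x : B ↦ TangentSpace 𝓘(ℝ, F) x)] {c x : B} {y : F}

/-- The metric in the chart centred at `c`, that is `metricCoord c`, as a field of continuous
bilinear forms. -/
def metricForm (c : B) (y : F) : F →L[ℝ] F →L[ℝ] ℝ :=
  let x := (extChartAt 𝓘(ℝ, F) c).symm y
  (innerSL ℝ (E := TangentSpace 𝓘(ℝ, F) x)).bilinearComp (ofCoordVec c x) (ofCoordVec c x)

lemma metricForm_apply (c : B) (y u v : F) : metricForm c y u v = metricCoord c y u v :=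
  rfl

lemma inner_eq_metricForm [IsManifold 𝓘(ℝ, F) ∞ B] (hx : x ∈ (chartAt F c).source)
    (v w : TangentSpace 𝓘(ℝ, F) x) :
    inner ℝ v w = metricForm c (extChartAt 𝓘(ℝ, F) c x) (coordVec c x v) (coordVec c x w) := by
  rw [metricForm_apply, metricCoord, (extChartAt 𝓘(ℝ, F) c).left_inv (by simpa using hx),
    ofCoordVec_coordVec hx, ofCoordVec_coordVec hx]

variable [IsManifold 𝓘(ℝ, F) ∞ B] [FiniteDimensional ℝ F]
  [IsContMDiffRiemannianBundle 𝓘(ℝ, F) ∞ F (fun x : B ↦ TangentSpace 𝓘(ℝ, F) x)]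

lemma contDiffAt_metricForm (hy : y ∈ (extChartAt 𝓘(ℝ, F) c).target) :
    ContDiffAt ℝ ∞ (metricForm c) y := by
  have hsmooth (u v : F) : ContDiffOn ℝ ∞ (fun y ↦ metricForm c y u v)
      (extChartAt 𝓘(ℝ, F) c).target := by
    have hinner := ContMDiffOn.inner_bundle (F := F) (E := fun x : B ↦ TangentSpace 𝓘(ℝ, F) x)
      (b := fun x : B ↦ x) (v := fun x ↦ ofCoordVec c x u) (w := fun x ↦ ofCoordVec c x v)
      (smoothFieldOn_ofCoordVec c u) (smoothFieldOn_ofCoordVec c v)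
    exact (hinner.comp (contMDiffOn_extChartAt_symm c)
      fun _ hz ↦ symm_mem_chart_source hz).contDiffOn
  exact (contDiffOn_clm_apply.2 fun u ↦ contDiffOn_clm_apply.2 fun v ↦ hsmooth u v).contDiffAt
    ((isOpen_extChartAt_target c).mem_nhds hy)

lemma isMetricAt_metricForm (hy : y ∈ (extChartAt 𝓘(ℝ, F) c).target) :
    IsMetricAt (metricForm c) y where
  contDiffAt := (contDiffAt_metricForm hy).of_le (WithTop.coe_le_coe.2 le_top)
  eventually_symm := Eventually.of_forall fun z v w ↦ by
    rw [metricForm_apply, metricForm_apply, metricCoord, metricCoord, real_inner_comm]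
  pos u hu := by
    rw [metricForm_apply, metricCoord, real_inner_self_pos]
    refine fun h0 ↦ hu ?_
    rw [← coordVec_ofCoordVec (symm_mem_chart_source hy) u, h0, map_zero]

lemma christoffelFirst_eq_koszulForm (hy : y ∈ (extChartAt 𝓘(ℝ, F) c).target) (u v w : F) :
    christoffelFirst c y u v w = koszulForm (metricForm c) y u v w := by
  have hG := (isMetricAt_metricForm hy).differentiableAt
  have hd (a v w : F) :
      fderiv ℝ (fun z ↦ metricCoord c z v w) y a = fderiv ℝ (metricForm c) y a v w := by
    simp only [← metricForm_apply]
    rw [fderiv_clm_apply (hG.clm_apply (differentiableAt_const v)) (differentiableAt_const w),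
      fderiv_clm_apply hG (differentiableAt_const v)]
    simp
  rw [koszulForm_apply, christoffelFirst, hd, hd, hd]

lemma isUnit_gramMatrix (hy : y ∈ (extChartAt 𝓘(ℝ, F) c).target) : IsUnit (gramMatrix c y) := by
  have hsep : (metricForm c y).toLinearMap₁₂.SeparatingLeft := fun u hu ↦
    (isMetricAt_metricForm hy).eq_of_forall fun w ↦ by simpa using hu w
  have hgram : gramMatrix c y = LinearMap.toMatrix₂ (Module.finBasis ℝ F) (Module.finBasis ℝ F)
      (metricForm c y).toLinearMap₁₂ := by
    ext i j
    rw [LinearMap.toMatrix₂_apply]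
    rfl
  rw [Matrix.isUnit_iff_isUnit_det, isUnit_iff_ne_zero, hgram]
  exact (LinearMap.separatingLeft_iff_det_ne_zero _).1 hsep

lemma christoffel_eq_localChristoffel (hy : y ∈ (extChartAt 𝓘(ℝ, F) c).target) (u v : F) :
    christoffel c y u v = localChristoffel (metricForm c) y u v := by
  have hG := isMetricAt_metricForm hy
  set b := Module.finBasis ℝ F
  have hsolve : (fun l ↦ christoffelFirst c y u v (b l)) =
      (gramMatrix c y).mulVec (b.repr (localChristoffel (metricForm c) y u v)) := by
    ext l
    rw [christoffelFirst_eq_koszulForm hy, ← hG.apply_localChristoffel, hG.symm,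
      ← b.sum_repr (localChristoffel (metricForm c) y u v), map_sum, b.sum_repr]
    refine Finset.sum_congr rfl fun k _ ↦ ?_
    rw [map_smul, smul_eq_mul, mul_comm]
    rfl
  have := (isUnit_gramMatrix hy).invertible
  rw [← b.sum_repr (localChristoffel (metricForm c) y u v), ← Matrix.inv_mulVec_eq_vec hsolve]
  rfl

end ChartMetric

section CoordinateRepresentation

variable {E : Type*} [NormedAddCommGroup E] [NormedSpace ℝ E]
  {N : Type*} [TopologicalSpace N] [ChartedSpace E N]
  {F : Type*} [NormedAddCommGroup F] [NormedSpace ℝ F]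
  {B : Type*} [TopologicalSpace B] [ChartedSpace F B]

/-- The map `f` in the charts centred at `p` (in the source) and `c` (in the target). -/
def coordRep (c : B) (f : N → B) (p : N) (x : E) : F :=
  extChartAt 𝓘(ℝ, F) c (f ((extChartAt 𝓘(ℝ, E) p).symm x))

variable {c : B} {f : N → B} {p q : N}

lemma coordRep_extChartAt (c : B) (f : N → B) (hq : q ∈ (chartAt E p).source) :
    coordRep (E := E) (F := F) c f p (extChartAt 𝓘(ℝ, E) p q) = extChartAt 𝓘(ℝ, F) c (f q) := by
  rw [coordRep, (extChartAt 𝓘(ℝ, E) p).left_inv (by simpa using hq)]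

omit [NormedSpace ℝ F] in
lemma eventually_mem_charts (hf : ContinuousAt f p) (hc : f p ∈ (chartAt F c).source) :
    ∀ᶠ x in 𝓝 (extChartAt 𝓘(ℝ, E) p p), x ∈ (extChartAt 𝓘(ℝ, E) p).target ∧
      f ((extChartAt 𝓘(ℝ, E) p).symm x) ∈ (chartAt F c).source := by
  refine Eventually.and (extChartAt_target_mem_nhds p) ?_
  have hcont : ContinuousAt (f ∘ (extChartAt 𝓘(ℝ, E) p).symm) (extChartAt 𝓘(ℝ, E) p p) :=
    ContinuousAt.comp (by rwa [extChartAt_to_inv]) (continuousAt_extChartAt_symm p)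
  refine hcont.eventually_mem ((chartAt F c).open_source.mem_nhds ?_)
  rwa [Function.comp_apply, extChartAt_to_inv]

variable [IsManifold 𝓘(ℝ, E) ∞ N]

lemma mvfderiv_eq_fderiv_coordVec {g : N → F} {g' : E → F}
    (hg : (fun x ↦ g ((extChartAt 𝓘(ℝ, E) p).symm x)) =ᶠ[𝓝 (extChartAt 𝓘(ℝ, E) p q)] g')
    (hg' : DifferentiableAt ℝ g' (extChartAt 𝓘(ℝ, E) p q)) (hq : q ∈ (chartAt E p).source)
    (w : TangentSpace 𝓘(ℝ, E) q) :
    mvfderiv 𝓘(ℝ, E) g q w = fderiv ℝ g' (extChartAt 𝓘(ℝ, E) p q) (coordVec p q w) := by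
  have hchart : MDifferentiableAt 𝓘(ℝ, E) 𝓘(ℝ, E) (extChartAt 𝓘(ℝ, E) p) q :=
    mdifferentiableAt_extChartAt hq
  have hcomp : g =ᶠ[𝓝 q] g' ∘ extChartAt 𝓘(ℝ, E) p := by
    filter_upwards [hchart.continuousAt.eventually hg, (chartAt E p).open_source.mem_nhds hq]
      with x hx hxs
    rw [Function.comp_apply, ← hx, (extChartAt 𝓘(ℝ, E) p).left_inv (by simpa using hxs)]
  have hchain := hcomp.mfderiv_eq (I := 𝓘(ℝ, E)) (I' := 𝓘(ℝ, F))
  rw [mfderiv_comp q hg'.mdifferentiableAt hchart, mfderiv_eq_fderiv] at hchain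
  exact (DFunLike.congr_fun hchain w :)

variable [IsManifold 𝓘(ℝ, F) ∞ B]

lemma contDiffAt_coordRep {n : WithTop ℕ∞} [ENat.LEInfty n] {x : E}
    (hx : x ∈ (extChartAt 𝓘(ℝ, E) p).target)
    (hfx : f ((extChartAt 𝓘(ℝ, E) p).symm x) ∈ (chartAt F c).source)
    (hf : ContMDiffAt 𝓘(ℝ, E) 𝓘(ℝ, F) n f ((extChartAt 𝓘(ℝ, E) p).symm x)) :
    ContDiffAt ℝ n (coordRep (E := E) (F := F) c f p) x :=
  ((contMDiffAt_extChartAt' hfx).comp x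
    (hf.comp x ((contMDiffAt_extChartAt_symm hx).of_le ENat.LEInfty.out))).contDiffAt

lemma coordVec_mfderiv (hq : q ∈ (chartAt E p).source) (hfq : f q ∈ (chartAt F c).source)
    (hf : MDifferentiableAt 𝓘(ℝ, E) 𝓘(ℝ, F) f q) (w : TangentSpace 𝓘(ℝ, E) q) :
    coordVec c (f q) (mfderiv 𝓘(ℝ, E) 𝓘(ℝ, F) f q w) =
      fderiv ℝ (coordRep (E := E) c f p) (extChartAt 𝓘(ℝ, E) p q) (coordVec p q w) := by
  have hchart : MDifferentiableAt 𝓘(ℝ, F) 𝓘(ℝ, F) (extChartAt 𝓘(ℝ, F) c) (f q) :=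
    mdifferentiableAt_extChartAt hfq
  have hq' := (extChartAt 𝓘(ℝ, E) p).left_inv (by simpa using hq)
  have hsymm : MDifferentiableAt 𝓘(ℝ, E) 𝓘(ℝ, E) (extChartAt 𝓘(ℝ, E) p).symm
      (extChartAt 𝓘(ℝ, E) p q) :=
    (contMDiffAt_extChartAt_symm ((extChartAt 𝓘(ℝ, E) p).map_source
      (by simpa using hq))).mdifferentiableAt (by simp)
  have hrep : DifferentiableAt ℝ (coordRep (E := E) (F := F) c f p) (extChartAt 𝓘(ℝ, E) p q) := by
    refine MDifferentiableAt.differentiableAt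
      (MDifferentiableAt.comp (g := extChartAt 𝓘(ℝ, F) c ∘ f) _ ?_ hsymm)
    rw [hq']
    exact hchart.comp q hf
  exact (DFunLike.congr_fun (mfderiv_comp q hchart hf) w).symm.trans
    (mvfderiv_eq_fderiv_coordVec (g := extChartAt 𝓘(ℝ, F) c ∘ f) EventuallyEq.rfl hrep hq w)

variable [FiniteDimensional ℝ F] [RiemannianBundle (fun x : B ↦ TangentSpace 𝓘(ℝ, F) x)]
  [IsContMDiffRiemannianBundle 𝓘(ℝ, F) ∞ F (fun x : B ↦ TangentSpace 𝓘(ℝ, F) x)]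

lemma coordVec_covDerivAlongIn {V : ∀ q : N, TangentSpace 𝓘(ℝ, F) (f q)} {V' : E → F}
    (hc : f p ∈ (chartAt F c).source) (hf : MDifferentiableAt 𝓘(ℝ, E) 𝓘(ℝ, F) f p)
    (hV : (fun x ↦ coordVec c (f ((extChartAt 𝓘(ℝ, E) p).symm x))
      (V ((extChartAt 𝓘(ℝ, E) p).symm x))) =ᶠ[𝓝 (extChartAt 𝓘(ℝ, E) p p)] V')
    (hV' : DifferentiableAt ℝ V' (extChartAt 𝓘(ℝ, E) p p)) (w : TangentSpace 𝓘(ℝ, E) p) :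
    coordVec c (f p) (covDerivAlongIn c f V p w) =
      localCovDeriv (metricForm c) (coordRep (E := E) c f p) V' (extChartAt 𝓘(ℝ, E) p p)
        (coordVec p p w) := by
  have hp := mem_chart_source E p
  have hVp : coordVec c (f p) (V p) = V' (extChartAt 𝓘(ℝ, E) p p) :=
    (congrArg (fun q ↦ coordVec c (f q) (V q)) (extChartAt_to_inv (I := 𝓘(ℝ, E)) p)).symm.trans
      hV.self_of_nhds
  rw [covDerivAlongIn, coordVec_ofCoordVec hc,
    mvfderiv_eq_fderiv_coordVec (g := fun q ↦ coordVec c (f q) (V q)) hV hV' hp,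
    coordVec_mfderiv hp hc hf, hVp, localCovDeriv_apply, coordRep_extChartAt c f hp,
    christoffel_eq_localChristoffel ((extChartAt 𝓘(ℝ, F) c).map_source (by simpa using hc))]

end CoordinateRepresentation

section PushforwardCovDeriv

variable {E : Type*} [NormedAddCommGroup E] [NormedSpace ℝ E]
  {M : Type*} [TopologicalSpace M] [ChartedSpace E M] [IsManifold 𝓘(ℝ, E) ∞ M]
  {F : Type*} [NormedAddCommGroup F] [NormedSpace ℝ F] [FiniteDimensional ℝ F]
  {B : Type*} [TopologicalSpace B] [ChartedSpace F B]
  [RiemannianBundle (fun x : B ↦ TangentSpace 𝓘(ℝ, F) x)]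

/-- The covariant derivative `∇^f_w (f_* Z)` at `p`, where `Z` is Mathlib's standard local extension
of `z`: the part of the second fundamental form that does not involve the metric of the source. -/
def pushforwardCovDeriv (f : M → B) (p : M) (w z : TangentSpace 𝓘(ℝ, E) p) :
    TangentSpace 𝓘(ℝ, F) (f p) :=
  covDerivAlong f (fun q ↦ pushforward (E := E) (F := F) f q (FiberBundle.extend E z q)) p w

variable {f : M → B} [IsManifold 𝓘(ℝ, F) ∞ B]

omit [FiniteDimensional ℝ F] [RiemannianBundle (fun x : B ↦ TangentSpace 𝓘(ℝ, F) x)] in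
lemma coordVec_pushforward (hf : ContMDiff 𝓘(ℝ, E) 𝓘(ℝ, F) 2 f) (p : M)
    (w : TangentSpace 𝓘(ℝ, E) p) :
    coordVec (f p) (f p) (pushforward (E := E) (F := F) f p w) =
      fderiv ℝ (coordRep (E := E) (F := F) (f p) f p) (extChartAt 𝓘(ℝ, E) p p)
        (coordVec p p w) :=
  coordVec_mfderiv (mem_chart_source E p) (mem_chart_source F (f p))
    (hf.mdifferentiable two_ne_zero p) w

variable [IsContMDiffRiemannianBundle 𝓘(ℝ, F) ∞ F (fun x : B ↦ TangentSpace 𝓘(ℝ, F) x)]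

lemma coordVec_pushforwardCovDeriv (hf : ContMDiff 𝓘(ℝ, E) 𝓘(ℝ, F) 2 f) (p : M)
    (w z : TangentSpace 𝓘(ℝ, E) p) :
    coordVec (f p) (f p) (pushforwardCovDeriv (F := F) f p w z) =
      localHessian (metricForm (f p)) (coordRep (E := E) (f p) f p) (extChartAt 𝓘(ℝ, E) p p)
        (coordVec p p w) (coordVec p p z) := by
  have hd := hf.mdifferentiable two_ne_zero
  have hcharts := eventually_mem_charts (E := E) (f := f) (p := p) hf.continuous.continuousAt
    (mem_chart_source F (f p))
  have hrep : ContDiffAt ℝ 2 (coordRep (E := E) (F := F) (f p) f p) (extChartAt 𝓘(ℝ, E) p p) :=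
    contDiffAt_coordRep hcharts.self_of_nhds.1 hcharts.self_of_nhds.2 hf.contMDiffAt
  refine coordVec_covDerivAlongIn (mem_chart_source F (f p)) (hd p) ?_
    (((hrep.fderiv_right one_add_one_eq_two.le).differentiableAt one_ne_zero).clm_apply
      (differentiableAt_const _)) w
  filter_upwards [hcharts] with x ⟨hx, hfx⟩
  have hs := symm_mem_chart_source hx
  rw [pushforward, coordVec_mfderiv hs hfx (hd _), coordVec_extend hs,
    (extChartAt 𝓘(ℝ, E) p).right_inv hx]

end PushforwardCovDeriv

section Geodesics

variable {E : Type*} [NormedAddCommGroup E] [NormedSpace ℝ E]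
  {F : Type*} [NormedAddCommGroup F] [NormedSpace ℝ F]

lemma localCovDeriv_congr {G : F → F →L[ℝ] F →L[ℝ] ℝ} {f f' V : E → F} {x : E}
    (h : f =ᶠ[𝓝 x] f') : localCovDeriv G f V x = localCovDeriv G f' V x := by
  rw [localCovDeriv, localCovDeriv, h.fderiv_eq, h.self_of_nhds]

lemma coordVec_one (c s : ℝ) : coordVec c s (1 : ℝ) = (1 : ℝ) := by
  rw [coordVec, extChartAt_model_space_eq_id, PartialEquiv.refl_coe]
  exact DFunLike.congr_fun mfderiv_id (1 : ℝ)

variable {γ σ : ℝ → F} {J : Set ℝ}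

lemma IsLocalGeodesicOn.contDiffOn [FiniteDimensional ℝ F] {G : F → F →L[ℝ] F →L[ℝ] ℝ}
    (hγ : IsLocalGeodesicOn G γ σ J) (hJ : IsOpen J) (hG : ∀ s ∈ J, IsMetricAt G (γ s)) :
    ContDiffOn ℝ 2 γ J := by
  have hacc : ContinuousOn (fun s ↦ localChristoffel G (γ s) (σ s) (σ s)) J := fun s hs ↦
    have hσ := (hγ s hs).2.continuousAt
    ((((hG s hs).contDiffAt_localChristoffel.continuousAt.comp (hγ s hs).1.continuousAt).clm_apply
      hσ).clm_apply hσ).continuousWithinAt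
  have hσ : ContDiffOn ℝ (0 + 1) σ J := (contDiffOn_succ_iff_deriv_of_isOpen hJ).2
    ⟨fun s hs ↦ (hγ s hs).2.differentiableAt.differentiableWithinAt, by simp,
      contDiffOn_zero.2 (hacc.neg.congr fun s hs ↦ (hγ s hs).2.deriv)⟩
  rw [zero_add] at hσ
  have hγ2 : ContDiffOn ℝ (1 + 1) γ J := (contDiffOn_succ_iff_deriv_of_isOpen hJ).2
    ⟨fun s hs ↦ (hγ s hs).1.differentiableAt.differentiableWithinAt, by simp,
      hσ.congr fun s hs ↦ (hγ s hs).1.deriv⟩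
  rwa [one_add_one_eq_two] at hγ2

variable {B : Type*} [TopologicalSpace B] [ChartedSpace F B] {b : B}

lemma coordRep_symm_comp_eventuallyEq (hJ : IsOpen J)
    (hmem : MapsTo γ J (extChartAt 𝓘(ℝ, F) b).target) {s : ℝ} (hs : s ∈ J) :
    coordRep b ((extChartAt 𝓘(ℝ, F) b).symm ∘ γ) s =ᶠ[𝓝 s] γ := by
  filter_upwards [hJ.mem_nhds hs] with t ht
  exact (extChartAt 𝓘(ℝ, F) b).right_inv (hmem ht)

variable [IsManifold 𝓘(ℝ, F) ∞ B]

lemma mdifferentiableAt_symm_comp {s : ℝ} (hs : γ s ∈ (extChartAt 𝓘(ℝ, F) b).target)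
    (hγ : DifferentiableAt ℝ γ s) :
    MDifferentiableAt 𝓘(ℝ, ℝ) 𝓘(ℝ, F) ((extChartAt 𝓘(ℝ, F) b).symm ∘ γ) s :=
  ((contMDiffAt_extChartAt_symm hs).mdifferentiableAt (by simp)).comp s hγ.mdifferentiableAt

lemma coordVec_velocity (hJ : IsOpen J) (hmem : MapsTo γ J (extChartAt 𝓘(ℝ, F) b).target)
    {s : ℝ} (hs : s ∈ J) (hγ : HasDerivAt γ (σ s) s) :
    coordVec b ((extChartAt 𝓘(ℝ, F) b).symm (γ s))
      (velocity (F := F) ((extChartAt 𝓘(ℝ, F) b).symm ∘ γ) s) = σ s := by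
  have hsrc := symm_mem_chart_source (hmem hs)
  refine (coordVec_mfderiv (E := ℝ) (f := (extChartAt 𝓘(ℝ, F) b).symm ∘ γ) (mem_chart_source ℝ s)
    hsrc (mdifferentiableAt_symm_comp (hmem hs) hγ.differentiableAt) (1 : ℝ)).trans ?_
  rw [coordVec_one, extChartAt_model_space_eq_id, PartialEquiv.refl_coe, id,
    (coordRep_symm_comp_eventuallyEq hJ hmem hs).fderiv_eq, hγ.hasFDerivAt.fderiv]
  simp

variable [FiniteDimensional ℝ F] [RiemannianBundle (fun x : B ↦ TangentSpace 𝓘(ℝ, F) x)]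
  [IsContMDiffRiemannianBundle 𝓘(ℝ, F) ∞ F (fun x : B ↦ TangentSpace 𝓘(ℝ, F) x)]

lemma IsLocalGeodesicOn.isGeodesicOn (hγ : IsLocalGeodesicOn (metricForm b) γ σ J)
    (hJ : IsOpen J) (hmem : MapsTo γ J (extChartAt 𝓘(ℝ, F) b).target) :
    IsGeodesicOn (F := F) ((extChartAt 𝓘(ℝ, F) b).symm ∘ γ) J := by
  refine ⟨((contMDiffOn_extChartAt_symm (n := 2) b).comp
    (hγ.contDiffOn hJ fun s hs ↦ isMetricAt_metricForm (hmem hs)).contMDiffOn hmem), fun s hs ↦ ?_⟩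
  have hsrc := symm_mem_chart_source (hmem hs)
  refine ⟨b, hsrc, ?_⟩
  have hvel : (fun t ↦ coordVec b (((extChartAt 𝓘(ℝ, F) b).symm ∘ γ) t)
      (velocity (F := F) ((extChartAt 𝓘(ℝ, F) b).symm ∘ γ) t)) =ᶠ[𝓝 s] σ := by
    filter_upwards [hJ.mem_nhds hs] with t ht using coordVec_velocity hJ hmem ht (hγ t ht).1
  have hcoord := coordVec_covDerivAlongIn (E := ℝ) (f := (extChartAt 𝓘(ℝ, F) b).symm ∘ γ)
    (V := velocity (F := F) ((extChartAt 𝓘(ℝ, F) b).symm ∘ γ)) hsrc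
    (mdifferentiableAt_symm_comp (hmem hs) (hγ s hs).1.differentiableAt) hvel
    (hγ s hs).2.differentiableAt (1 : ℝ)
  rw [coordVec_one, extChartAt_model_space_eq_id, PartialEquiv.refl_coe, id,
    localCovDeriv_congr (coordRep_symm_comp_eventuallyEq hJ hmem hs),
    hγ.localCovDeriv_eq_zero hs] at hcoord
  exact (isInvertible_coordVec hsrc).injective (hcoord.trans (map_zero _).symm)

end Geodesics

section AlmostContact

variable {F : Type*} [NormedAddCommGroup F] [NormedSpace ℝ F]
  {B : Type*} [TopologicalSpace B] [ChartedSpace F B] [IsManifold 𝓘(ℝ, F) ∞ B]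
  [RiemannianBundle (fun x : B ↦ TangentSpace 𝓘(ℝ, F) x)]

namespace AlmostContactMetric

/-- The `(1,1)`-tensor `ψ` in the chart centred at `c`. -/
def ψCoord (S : AlmostContactMetric F B) (c : B) (y : F) : F →L[ℝ] F :=
  let x := (extChartAt 𝓘(ℝ, F) c).symm y
  (coordVec c x).comp ((S.ψ x).comp (ofCoordVec c x))

lemma ψCoord_coordVec (S : AlmostContactMetric F B) {c x : B} (hx : x ∈ (chartAt F c).source)
    (v : TangentSpace 𝓘(ℝ, F) x) :
    S.ψCoord c (extChartAt 𝓘(ℝ, F) c x) (coordVec c x v) = coordVec c x (S.ψ x v) := by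
  simp only [ψCoord, ContinuousLinearMap.comp_apply]
  rw [(extChartAt 𝓘(ℝ, F) c).left_inv (by simpa using hx), ofCoordVec_coordVec hx]

variable [FiniteDimensional ℝ F]

lemma differentiableAt_ψCoord (S : AlmostContactMetric F B) {c : B} {y : F}
    (hy : y ∈ (extChartAt 𝓘(ℝ, F) c).target) : DifferentiableAt ℝ (S.ψCoord c) y := by
  have hfield (u : F) : SmoothFieldOn (fun x ↦ S.ψ x (ofCoordVec c x u)) (chartAt F c).source :=
    ContMDiffOn.clm_bundle_apply (E₁ := fun x : B ↦ TangentSpace 𝓘(ℝ, F) x) (F₁ := F)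
      (E₂ := fun x : B ↦ TangentSpace 𝓘(ℝ, F) x) (F₂ := F) (b := fun x : B ↦ x)
      S.smooth_ψ.contMDiffOn (smoothFieldOn_ofCoordVec c u)
  have hsmooth : ContDiffOn ℝ ∞ (S.ψCoord c) (extChartAt 𝓘(ℝ, F) c).target :=
    contDiffOn_clm_apply.2 fun u z hz ↦ ((hfield u).contDiffAt_coordVec
      (chartAt F c).open_source hz (symm_mem_chart_source hz)).contDiffWithinAt
  exact (hsmooth.contDiffAt ((isOpen_extChartAt_target c).mem_nhds hy)).differentiableAt (by simp)

end AlmostContactMetric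

variable [FiniteDimensional ℝ F]
  [IsContMDiffRiemannianBundle 𝓘(ℝ, F) ∞ F (fun x : B ↦ TangentSpace 𝓘(ℝ, F) x)]

lemma coordVec_leviCivita {X : ∀ x : B, TangentSpace 𝓘(ℝ, F) x} {b : B} {X' : F → F}
    (hX : (fun y ↦ coordVec b ((extChartAt 𝓘(ℝ, F) b).symm y) (X ((extChartAt 𝓘(ℝ, F) b).symm y)))
      =ᶠ[𝓝 (extChartAt 𝓘(ℝ, F) b b)] X')
    (hX' : DifferentiableAt ℝ X' (extChartAt 𝓘(ℝ, F) b b)) (w : TangentSpace 𝓘(ℝ, F) b) :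
    coordVec b b (leviCivita X b w) =
      localCovDeriv (metricForm b) id X' (extChartAt 𝓘(ℝ, F) b b) (coordVec b b w) := by
  have hid : coordRep b (fun x : B ↦ x) b =ᶠ[𝓝 (extChartAt 𝓘(ℝ, F) b b)] id := by
    filter_upwards [extChartAt_target_mem_nhds b] with y hy
    exact (extChartAt 𝓘(ℝ, F) b).right_inv hy
  rw [← localCovDeriv_congr hid]
  exact coordVec_covDerivAlongIn (f := fun x : B ↦ x) (mem_chart_source F b) mdifferentiableAt_id
    hX hX' w

namespace AlmostContactMetric

variable {S : AlmostContactMetric F B}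

lemma coordVec_leviCivita_ψ_sub (S : AlmostContactMetric F B) {b : B} (w : TangentSpace 𝓘(ℝ, F) b)
    (u : F) :
    coordVec b b (leviCivita (fun q ↦ S.ψ q (ofCoordVec b q u)) b w -
        S.ψ b (leviCivita (fun q ↦ ofCoordVec b q u) b w)) =
      localCovDerivEnd (metricForm b) (S.ψCoord b) (extChartAt 𝓘(ℝ, F) b b) (coordVec b b w) u := by
  have hψ := S.differentiableAt_ψCoord (mem_extChartAt_target (I := 𝓘(ℝ, F)) b)
  have hZ : coordVec b b (leviCivita (fun q ↦ ofCoordVec b q u) b w) =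
      localCovDeriv (metricForm b) id (fun _ ↦ u) (extChartAt 𝓘(ℝ, F) b b) (coordVec b b w) := by
    refine coordVec_leviCivita (X := fun q ↦ ofCoordVec b q u) ?_ (differentiableAt_const u) w
    filter_upwards [extChartAt_target_mem_nhds b] with y hy
    exact coordVec_ofCoordVec (symm_mem_chart_source hy) u
  have hψZ : coordVec b b (leviCivita (fun q ↦ S.ψ q (ofCoordVec b q u)) b w) =
      localCovDeriv (metricForm b) id (fun y ↦ S.ψCoord b y u) (extChartAt 𝓘(ℝ, F) b b)
        (coordVec b b w) :=
    coordVec_leviCivita (X := fun q ↦ S.ψ q (ofCoordVec b q u)) (X' := fun y ↦ S.ψCoord b y u)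
      (.of_forall fun _ ↦ rfl) (hψ.clm_apply (differentiableAt_const u)) w
  have hLeibniz := localCovDeriv_clm_apply (G := metricForm b) (f := id) (V := fun _ ↦ u) hψ
    differentiableAt_id (differentiableAt_const u) (coordVec b b w)
  rw [fderiv_id] at hLeibniz
  rw [map_sub, ← S.ψCoord_coordVec (mem_chart_source F b), hZ, hψZ, sub_eq_iff_eq_add]
  exact hLeibniz

lemma IsTransSasakian.metricForm_localCovDerivEnd {α β : B → ℝ} (hS : S.IsTransSasakian α β) {b : B}
    (w z x : TangentSpace 𝓘(ℝ, F) b) (hz : S.η b z = 0) (hx : inner ℝ (S.ξ b) x = 0) :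
    metricForm b (extChartAt 𝓘(ℝ, F) b b)
      (localCovDerivEnd (metricForm b) (S.ψCoord b) (extChartAt 𝓘(ℝ, F) b b) (coordVec b b w)
        (coordVec b b z)) (coordVec b b x) = 0 := by
  have hb := mem_chart_source F b
  have htrans := hS.2.2 _ _ (chartAt F b).open_source (smoothFieldOn_ofCoordVec b (coordVec b b z))
    b hb w
  rw [ofCoordVec_coordVec hb, hz, zero_smul, zero_smul, sub_zero, sub_zero, smul_smul, smul_smul,
    ← add_smul] at htrans
  rw [← coordVec_leviCivita_ψ_sub, ← inner_eq_metricForm hb, htrans]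
  exact (real_inner_smul_left _ _ _).trans (by rw [hx, mul_zero])

end AlmostContactMetric

end AlmostContact

section Angle

variable {V : Type*} [NormedAddCommGroup V] [InnerProductSpace ℝ V] {D : Submodule ℝ V} {x u : V}

lemma isGreatest_two_mul_inner_sub (hx : x ∈ D) (hu : u ∈ Dᗮ) :
    IsGreatest ((fun z ↦ 2 * inner ℝ z (x + u) - inner ℝ z z) '' D) (inner ℝ x x) := by
  have hsub (z : V) (hz : z ∈ D) : inner ℝ x x - (2 * inner ℝ z (x + u) - inner ℝ z z) =
      inner ℝ (z - x) (z - x) := by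
    rw [inner_sub_sub_self, inner_add_right, D.inner_right_of_mem_orthogonal hz hu,
      real_inner_comm z x]
    ring
  refine ⟨⟨x, hx, (sub_eq_zero.1 ?_).symm⟩, ?_⟩
  · exact (hsub x hx).trans (by rw [sub_self, inner_zero_left])
  · rintro _ ⟨z, hz, rfl⟩
    exact sub_nonneg.1 (hsub z hz ▸ real_inner_self_nonneg)

lemma inner_self_eq_sin_angle_sq_mul (hx : x ∈ D) (hu : u ∈ Dᗮ) :
    inner ℝ x x =
      Real.sin (InnerProductGeometry.angle (x + u) u) ^ 2 * inner ℝ (x + u) (x + u) := by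
  have hsin := InnerProductGeometry.sin_angle_add_mul_norm_of_inner_eq_zero
    (D.inner_left_of_mem_orthogonal hx hu)
  rw [add_comm u, InnerProductGeometry.angle_comm] at hsin
  rw [real_inner_self_eq_norm_sq, real_inner_self_eq_norm_sq, ← hsin, mul_pow]

end Angle

section Frames

variable {F : Type*} [NormedAddCommGroup F] [NormedSpace ℝ F]
  {B : Type*} [TopologicalSpace B] [ChartedSpace F B]

/-- The linear combinations of the vector fields `X i`, in the chart centred at `c`. -/
def frameCoord {k : ℕ} (X : Fin k → ∀ x : B, TangentSpace 𝓘(ℝ, F) x) (c : B) (y : F) :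
    (Fin k → ℝ) →L[ℝ] F :=
  let x := (extChartAt 𝓘(ℝ, F) c).symm y
  ∑ i, (ContinuousLinearMap.proj (R := ℝ) (φ := fun _ : Fin k ↦ ℝ) i).smulRight
    (coordVec c x (X i x))

variable {k : ℕ} {X : Fin k → ∀ x : B, TangentSpace 𝓘(ℝ, F) x} {c b : B} {y : F}

lemma frameCoord_apply (y : F) (a : Fin k → ℝ) :
    frameCoord X c y a = coordVec c ((extChartAt 𝓘(ℝ, F) c).symm y)
      (∑ i, a i • X i ((extChartAt 𝓘(ℝ, F) c).symm y)) := by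
  simp only [frameCoord, _root_.sum_apply, ContinuousLinearMap.smulRight_apply,
    ContinuousLinearMap.proj_apply, map_sum]
  exact Finset.sum_congr rfl fun i _ ↦ (map_smul _ _ _).symm

lemma range_frameCoord {x : B} (hx : x ∈ (chartAt F c).source) :
    range (frameCoord X c (extChartAt 𝓘(ℝ, F) c x)) =
      coordVec c x '' Submodule.span ℝ (range fun i ↦ X i x) := by
  ext v
  simp only [mem_range, mem_image, SetLike.mem_coe, Submodule.mem_span_range_iff_exists_fun,
    frameCoord_apply, exists_exists_eq_and]
  rw [(extChartAt 𝓘(ℝ, F) c).left_inv (by simpa using hx)]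

variable [IsManifold 𝓘(ℝ, F) ∞ B]

lemma differentiableAt_frameCoord {O : Set B} (hX : ∀ i, SmoothFieldOn (X i) O) (hO : IsOpen O)
    (hy : y ∈ (extChartAt 𝓘(ℝ, F) c).target) (hyO : (extChartAt 𝓘(ℝ, F) c).symm y ∈ O) :
    DifferentiableAt ℝ (frameCoord X c) y :=
  DifferentiableAt.fun_sum fun i _ ↦
    ((ContinuousLinearMap.smulRightL ℝ (Fin k → ℝ) F (ContinuousLinearMap.proj i)).differentiableAt
      |>.comp y (((hX i).contDiffAt_coordVec hO hy hyO).differentiableAt (by simp)))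

lemma injective_frameCoord (hy : y ∈ (extChartAt 𝓘(ℝ, F) c).target)
    (hX : LinearIndependent ℝ fun i ↦ X i ((extChartAt 𝓘(ℝ, F) c).symm y)) :
    Function.Injective (frameCoord X c y) := by
  refine (injective_iff_map_eq_zero _).2 fun a ha ↦ ?_
  rw [frameCoord_apply] at ha
  exact funext (Fintype.linearIndependent_iff.1 hX a
    ((isInvertible_coordVec (symm_mem_chart_source hy)).injective (ha.trans (map_zero _).symm)))

variable [RiemannianBundle (fun x : B ↦ TangentSpace 𝓘(ℝ, F) x)]

lemma metricForm_coordVec_symm (hy : y ∈ (extChartAt 𝓘(ℝ, F) c).target)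
    (v w : TangentSpace 𝓘(ℝ, F) ((extChartAt 𝓘(ℝ, F) c).symm y)) :
    metricForm c y (coordVec c _ v) (coordVec c _ w) = inner ℝ v w := by
  rw [inner_eq_metricForm (symm_mem_chart_source hy), (extChartAt 𝓘(ℝ, F) c).right_inv hy]

lemma isGreatest_metricForm_frameCoord (hy : y ∈ (extChartAt 𝓘(ℝ, F) c).target)
    {D : Submodule ℝ (TangentSpace 𝓘(ℝ, F) ((extChartAt 𝓘(ℝ, F) c).symm y))}
    (hD : Submodule.span ℝ (range fun i ↦ X i ((extChartAt 𝓘(ℝ, F) c).symm y)) = D)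
    {x u : TangentSpace 𝓘(ℝ, F) ((extChartAt 𝓘(ℝ, F) c).symm y)} (hx : x ∈ D) (hu : u ∈ Dᗮ) :
    IsGreatest (range fun a ↦ 2 * metricForm c y (frameCoord X c y a) (coordVec c _ (x + u)) -
      metricForm c y (frameCoord X c y a) (frameCoord X c y a)) (inner ℝ x x) := by
  convert isGreatest_two_mul_inner_sub hx hu using 1
  ext t
  simp only [frameCoord_apply, metricForm_coordVec_symm hy, mem_range, mem_image, SetLike.mem_coe,
    ← hD, Submodule.mem_span_range_iff_exists_fun, exists_exists_eq_and]

variable [FiniteDimensional ℝ F]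
  [IsContMDiffRiemannianBundle 𝓘(ℝ, F) ∞ F (fun x : B ↦ TangentSpace 𝓘(ℝ, F) x)]

lemma isLocalClairautOn_frameCoord {h : B → ℝ} {U O : Set B}
    {D : ∀ x : B, Submodule ℝ (TangentSpace 𝓘(ℝ, F) x)}
    (hD : ∀ x ∈ O, Submodule.span ℝ (range fun i ↦ X i x) = D x)
    (hC : ∀ (Ω : ℝ → B) (J : Set ℝ), IsOpen J → J.OrdConnected → MapsTo Ω J U →
      IsGeodesicOn (F := F) Ω J →
      ∃ C : ℝ, ∀ s ∈ J, ∀ X ∈ D (Ω s), ∀ V ∈ (D (Ω s))ᗮ, velocity (F := F) Ω s = X + V →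
        Real.exp (h (Ω s)) * Real.sin (InnerProductGeometry.angle (velocity (F := F) Ω s) V) = C) :
    IsLocalClairautOn (metricForm b) (frameCoord X b) (h ∘ (extChartAt 𝓘(ℝ, F) b).symm)
      ((extChartAt 𝓘(ℝ, F) b).target ∩ (extChartAt 𝓘(ℝ, F) b).symm ⁻¹' (U ∩ O)) := by
  intro γ σ J hJ hconn hmem hγ
  have htarget : MapsTo γ J (extChartAt 𝓘(ℝ, F) b).target := fun s hs ↦ (hmem hs).1
  set Ω : ℝ → B := (extChartAt 𝓘(ℝ, F) b).symm ∘ γ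
  obtain ⟨C, hC⟩ := hC Ω J hJ hconn (fun s hs ↦ (hmem hs).2.1) (hγ.isGeodesicOn hJ htarget)
  refine ⟨C ^ 2, fun s hs ↦ ?_⟩
  have : FiniteDimensional ℝ (TangentSpace 𝓘(ℝ, F) (Ω s)) := inferInstanceAs (FiniteDimensional ℝ F)
  obtain ⟨x, hx, u, hu, hxu⟩ := (D (Ω s)).exists_add_mem_mem_orthogonal (velocity (F := F) Ω s)
  have hsin := hC s hs x hx u hu hxu
  have hvel : coordVec b (Ω s) (x + u) = σ s := hxu ▸ coordVec_velocity hJ htarget hs (hγ s hs).1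
  have hexp : Real.exp (h (Ω s)) ^ 2 * Real.exp (-2 * h (Ω s)) = 1 := by
    rw [← Real.exp_nat_mul, ← Real.exp_add]
    simp
  have hgreatest := isGreatest_metricForm_frameCoord (htarget hs) (hD _ (hmem hs).2.2) hx hu
  have hinner : metricForm b (γ s) (coordVec b (Ω s) (x + u)) (coordVec b (Ω s) (x + u)) =
      inner ℝ (x + u) (x + u) := metricForm_coordVec_symm (htarget hs) _ _
  have hself : C ^ 2 * Real.exp (-2 * h (Ω s)) * metricForm b (γ s) (σ s) (σ s) = inner ℝ x x := by
    rw [← hvel, inner_self_eq_sin_angle_sq_mul hx hu, ← hsin, hxu, mul_pow,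
      hinner]
    linear_combination
      Real.sin (InnerProductGeometry.angle (x + u) u) ^ 2 * inner ℝ (x + u) (x + u) * hexp
  rw [Function.comp_apply]
  exact hself ▸ hvel ▸ hgreatest

end Frames

/-! ## The second fundamental form -/

section Pushforward

variable {E : Type*} [NormedAddCommGroup E] [NormedSpace ℝ E]
  {M : Type*} [TopologicalSpace M] [ChartedSpace E M]
  {F : Type*} [NormedAddCommGroup F] [NormedSpace ℝ F]
  {B : Type*} [TopologicalSpace B] [ChartedSpace F B]
  {f : M → B} {p : M}

lemma pushforward_mem_rangeAt {q : M} (v : TangentSpace 𝓘(ℝ, E) q) :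
    pushforward (F := F) f q v ∈ rangeAt (E := E) (F := F) f q :=
  ⟨v, rfl⟩

variable [IsManifold 𝓘(ℝ, E) ∞ M] [IsManifold 𝓘(ℝ, F) ∞ B]

lemma contDiffAt_coordRep_self {n : WithTop ℕ∞} [ENat.LEInfty n]
    (hf : ContMDiffAt 𝓘(ℝ, E) 𝓘(ℝ, F) n f p) :
    ContDiffAt ℝ n (coordRep (E := E) (F := F) (f p) f p) (extChartAt 𝓘(ℝ, E) p p) :=
  contDiffAt_coordRep (mem_extChartAt_target p)
    (by rw [extChartAt_to_inv]; exact mem_chart_source F (f p)) (by rwa [extChartAt_to_inv])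

lemma fderiv_coordRep (hf : MDifferentiable 𝓘(ℝ, E) 𝓘(ℝ, F) f) {x : E}
    (hx : x ∈ (extChartAt 𝓘(ℝ, E) p).target)
    (hfx : f ((extChartAt 𝓘(ℝ, E) p).symm x) ∈ (chartAt F (f p)).source) (z : E) :
    fderiv ℝ (coordRep (E := E) (F := F) (f p) f p) x z =
      coordVec (f p) (f ((extChartAt 𝓘(ℝ, E) p).symm x))
        (pushforward f ((extChartAt 𝓘(ℝ, E) p).symm x) (ofCoordVec p _ z)) := by
  have hs := symm_mem_chart_source hx
  rw [pushforward, coordVec_mfderiv hs hfx (hf _), coordVec_ofCoordVec hs,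
    (extChartAt 𝓘(ℝ, E) p).right_inv hx]

lemma differentiableAt_comp_extChartAt_symm {h : B → ℝ} {b : B}
    (hh : MDifferentiableAt 𝓘(ℝ, F) 𝓘(ℝ, ℝ) h b) :
    DifferentiableAt ℝ (h ∘ (extChartAt 𝓘(ℝ, F) b).symm) (extChartAt 𝓘(ℝ, F) b b) := by
  have hsymm := extChartAt_to_inv (I := 𝓘(ℝ, F)) b
  exact (MDifferentiableAt.comp _ (by rwa [hsymm]) ((contMDiffAt_extChartAt_symm
    (mem_extChartAt_target b)).mdifferentiableAt (by simp))).differentiableAt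

lemma eventually_fderiv_coordRep_mem_range_frameCoord {O : Set B} {k : ℕ}
    {X : Fin k → ∀ x : B, TangentSpace 𝓘(ℝ, F) x} (hf : ContMDiff 𝓘(ℝ, E) 𝓘(ℝ, F) 2 f)
    (hO : IsOpen O) (hp : f p ∈ O)
    (hspan : ∀ q, f q ∈ O → Submodule.span ℝ (range fun i ↦ X i (f q)) =
      rangeAt (E := E) (F := F) f q) :
    ∀ᶠ x in 𝓝 (extChartAt 𝓘(ℝ, E) p p), ∀ v,
      fderiv ℝ (coordRep (f p) f p) x v ∈ range (frameCoord X (f p) (coordRep (f p) f p x)) := by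
  have hfO : ∀ᶠ q in 𝓝 p, f q ∈ O := hf.continuous.continuousAt.eventually_mem (hO.mem_nhds hp)
  have hsymm : Tendsto (extChartAt 𝓘(ℝ, E) p).symm (𝓝 (extChartAt 𝓘(ℝ, E) p p)) (𝓝 p) := by
    simpa only [extChartAt_to_inv] using (continuousAt_extChartAt_symm (I := 𝓘(ℝ, E)) p).tendsto
  filter_upwards [eventually_mem_charts (E := E) (p := p) hf.continuous.continuousAt
    (mem_chart_source F (f p)), hsymm.eventually hfO] with x ⟨hx, hfx⟩ hxO v
  rw [coordRep, range_frameCoord hfx, hspan _ hxO,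
    fderiv_coordRep (hf.mdifferentiable two_ne_zero) hx hfx]
  exact mem_image_of_mem _ (pushforward_mem_rangeAt _)

variable [FiniteDimensional ℝ F] [RiemannianBundle (fun x : B ↦ TangentSpace 𝓘(ℝ, F) x)]
  [IsContMDiffRiemannianBundle 𝓘(ℝ, F) ∞ F (fun x : B ↦ TangentSpace 𝓘(ℝ, F) x)]

omit [IsManifold 𝓘(ℝ, E) ∞ M] in
lemma isMetricAt_coordRep :
    IsMetricAt (metricForm (f p))
      (coordRep (E := E) (F := F) (f p) f p (extChartAt 𝓘(ℝ, E) p p)) := by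
  rw [coordRep_extChartAt _ _ (mem_chart_source E p)]
  exact isMetricAt_metricForm (mem_extChartAt_target (f p))

lemma inner_pushforwardCovDeriv (hf : ContMDiff 𝓘(ℝ, E) 𝓘(ℝ, F) 2 f)
    (w z : TangentSpace 𝓘(ℝ, E) p) (u : TangentSpace 𝓘(ℝ, F) (f p)) :
    inner ℝ (pushforwardCovDeriv f p w z) u =
      metricForm (f p) (coordRep (E := E) (f p) f p (extChartAt 𝓘(ℝ, E) p p))
        (localHessian (metricForm (f p)) (coordRep (E := E) (f p) f p) (extChartAt 𝓘(ℝ, E) p p)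
          (coordVec p p w) (coordVec p p z)) (coordVec (f p) (f p) u) := by
  rw [inner_eq_metricForm (mem_chart_source F (f p)), coordVec_pushforwardCovDeriv hf,
    coordRep_extChartAt _ _ (mem_chart_source E p)]

section AntiInvariant

variable {S : AlmostContactMetric F B} {α β : B → ℝ}

omit [FiniteDimensional ℝ F]
  [IsContMDiffRiemannianBundle 𝓘(ℝ, F) ∞ F (fun x : B ↦ TangentSpace 𝓘(ℝ, F) x)] in
lemma AlmostContactMetric.metricForm_ψCoord (S : AlmostContactMetric F B) {c : B} {y : F}
    (hy : y ∈ (extChartAt 𝓘(ℝ, F) c).target) (u v : F) :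
    metricForm c y (S.ψCoord c y u) v = -metricForm c y u (S.ψCoord c y v) := by
  have hx := symm_mem_chart_source hy
  rw [← (extChartAt 𝓘(ℝ, F) c).right_inv hy, ← coordVec_ofCoordVec hx u,
    ← coordVec_ofCoordVec hx v, S.ψCoord_coordVec hx, S.ψCoord_coordVec hx,
    ← inner_eq_metricForm hx, ← inner_eq_metricForm hx, S.inner_ψ]

omit [FiniteDimensional ℝ F]
  [IsContMDiffRiemannianBundle 𝓘(ℝ, F) ∞ F (fun x : B ↦ TangentSpace 𝓘(ℝ, F) x)] in
lemma eventually_metricForm_ψCoord_eq_zero (hf : ContMDiff 𝓘(ℝ, E) 𝓘(ℝ, F) 2 f)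
    (hanti : IsAntiInvariant (E := E) S f) :
    ∀ᶠ x in 𝓝 (extChartAt 𝓘(ℝ, E) p p), ∀ z z',
      metricForm (f p) (coordRep (f p) f p x) (S.ψCoord (f p) (coordRep (f p) f p x)
        (fderiv ℝ (coordRep (f p) f p) x z)) (fderiv ℝ (coordRep (f p) f p) x z') = 0 := by
  have hd := hf.mdifferentiable two_ne_zero
  filter_upwards [eventually_mem_charts (E := E) (p := p) hf.continuous.continuousAt
    (mem_chart_source F (f p))] with x ⟨hx, hfx⟩ z z'
  rw [fderiv_coordRep hd hx hfx, fderiv_coordRep hd hx hfx, coordRep, S.ψCoord_coordVec hfx,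
    ← inner_eq_metricForm hfx]
  exact Submodule.inner_left_of_mem_orthogonal (pushforward_mem_rangeAt _)
    (hanti _ _ (pushforward_mem_rangeAt _))

lemma AlmostContactMetric.IsTransSasakian.inner_pushforwardCovDeriv_ψ_comm
    (hS : S.IsTransSasakian α β) (hf : ContMDiff 𝓘(ℝ, E) 𝓘(ℝ, F) 2 f)
    (hanti : IsAntiInvariant (E := E) S f) (hξ : HasHorizontalReeb (E := E) S f)
    (w z z' : TangentSpace 𝓘(ℝ, E) p) :
    inner ℝ (pushforwardCovDeriv f p w z) (S.ψ (f p) (pushforward f p z')) =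
      (inner ℝ (pushforwardCovDeriv f p w z') (S.ψ (f p) (pushforward f p z)) : ℝ) := by
  have hp := mem_chart_source E p
  have hb := mem_chart_source F (f p)
  have hy := mem_extChartAt_target (I := 𝓘(ℝ, F)) (f p)
  have hrep := coordRep_extChartAt (F := F) (f p) f hp
  have hmem (v : TangentSpace 𝓘(ℝ, E) p) := pushforward_mem_rangeAt (F := F) (f := f) v
  have hcov (w z z' : E) : metricForm (f p) (extChartAt 𝓘(ℝ, F) (f p) (f p))
      (localCovDerivEnd (metricForm (f p)) (S.ψCoord (f p)) (extChartAt 𝓘(ℝ, F) (f p) (f p))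
        (fderiv ℝ (coordRep (f p) f p) (extChartAt 𝓘(ℝ, E) p p) w)
        (fderiv ℝ (coordRep (f p) f p) (extChartAt 𝓘(ℝ, E) p p) z))
      (fderiv ℝ (coordRep (f p) f p) (extChartAt 𝓘(ℝ, E) p p) z') = 0 := by
    rw [← coordVec_ofCoordVec hp w, ← coordVec_ofCoordVec hp z, ← coordVec_ofCoordVec hp z']
    simp only [← coordVec_pushforward hf]
    refine hS.metricForm_localCovDerivEnd _ _ _ ?_ ?_
    · rw [S.η_eq]
      exact Submodule.inner_right_of_mem_orthogonal (hmem _) (hξ p)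
    · exact Submodule.inner_left_of_mem_orthogonal (hmem _) (hξ p)
  have hcomm := metric_localHessian_comm_of_antiInvariant isMetricAt_coordRep
    (contDiffAt_coordRep_self hf.contMDiffAt)
    (hrep ▸ S.differentiableAt_ψCoord hy)
    (hrep ▸ S.metricForm_ψCoord hy) (eventually_metricForm_ψCoord_eq_zero hf hanti)
    (hrep ▸ hcov) (coordVec p p w) (coordVec p p z) (coordVec p p z')
  simpa only [← coordVec_pushforward hf, hrep, S.ψCoord_coordVec hb, inner_pushforwardCovDeriv hf]
    using hcomm

end AntiInvariant

section Clairaut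

variable {h : B → ℝ}

lemma inner_pushforwardCovDeriv_of_isLocalClairautOn {O : Set B} {k : ℕ}
    {X : Fin k → ∀ x : B, TangentSpace 𝓘(ℝ, F) x}
    (hC : IsLocalClairautOn (metricForm (f p)) (frameCoord X (f p))
      (h ∘ (extChartAt 𝓘(ℝ, F) (f p)).symm)
      ((extChartAt 𝓘(ℝ, F) (f p)).target ∩ (extChartAt 𝓘(ℝ, F) (f p)).symm ⁻¹' O))
    (hO : IsOpen O) (hp : f p ∈ O) (hX : ∀ i, SmoothFieldOn (X i) O)
    (hLI : ∀ x ∈ O, LinearIndependent ℝ fun i ↦ X i x)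
    (hspan : ∀ q, f q ∈ O → Submodule.span ℝ (range fun i ↦ X i (f q)) =
      rangeAt (E := E) (F := F) f q)
    (hf : ContMDiff 𝓘(ℝ, E) 𝓘(ℝ, F) 2 f) (hh : MDifferentiableAt 𝓘(ℝ, F) 𝓘(ℝ, ℝ) h (f p))
    (w z : TangentSpace 𝓘(ℝ, E) p) {u : TangentSpace 𝓘(ℝ, F) (f p)}
    (hu : u ∈ (rangeAt (E := E) (F := F) f p)ᗮ) :
    inner ℝ (pushforwardCovDeriv f p w z) u =
      -(inner ℝ (pushforward (F := F) f p w) (pushforward f p z) *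
        mvfderiv 𝓘(ℝ, F) h (f p) u) := by
  have hb := mem_chart_source F (f p)
  have hy := mem_extChartAt_target (I := 𝓘(ℝ, F)) (f p)
  have hrep := coordRep_extChartAt (F := F) (f p) f (mem_chart_source E p)
  have hpO : (extChartAt 𝓘(ℝ, F) (f p)).symm (extChartAt 𝓘(ℝ, F) (f p) (f p)) ∈ O := by
    rwa [extChartAt_to_inv]
  have hnhds : (extChartAt 𝓘(ℝ, F) (f p)).target ∩ (extChartAt 𝓘(ℝ, F) (f p)).symm ⁻¹' O ∈
      𝓝 (extChartAt 𝓘(ℝ, F) (f p) (f p)) :=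
    inter_mem (extChartAt_target_mem_nhds (f p))
      ((continuousAt_extChartAt_symm (f p)).preimage_mem_nhds (hO.mem_nhds hpO))
  have hperp (a : Fin k → ℝ) : metricForm (f p) (extChartAt 𝓘(ℝ, F) (f p) (f p))
      (frameCoord X (f p) (extChartAt 𝓘(ℝ, F) (f p) (f p)) a) (coordVec (f p) (f p) u) = 0 := by
    obtain ⟨v, hv, hva⟩ := (range_frameCoord (X := X) hb).subset (mem_range_self a)
    rw [← hva, ← inner_eq_metricForm hb]
    exact Submodule.inner_right_of_mem_orthogonal (hspan p hp ▸ hv) hu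
  have hlocal := hC.metric_localHessian (isMetricAt_coordRep (E := E)) (hrep ▸ hnhds)
    (hrep ▸ differentiableAt_frameCoord hX hO hy hpO)
    (hrep ▸ injective_frameCoord hy (hLI _ hpO))
    (hrep ▸ differentiableAt_comp_extChartAt_symm hh) (hrep ▸ hperp)
    (contDiffAt_coordRep_self hf.contMDiffAt)
    (eventually_fderiv_coordRep_mem_range_frameCoord hf hO hp hspan)
    (coordVec p p w) (coordVec p p z)
  rw [inner_pushforwardCovDeriv hf, hlocal, ← coordVec_pushforward hf, ← coordVec_pushforward hf,
    hrep, ← inner_eq_metricForm hb, mvfderiv_eq_fderiv_coordVec (g := h) EventuallyEq.rfl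
      (differentiableAt_comp_extChartAt_symm hh) hb]
  rfl

lemma IsClairautMap.inner_pushforwardCovDeriv
    (hC : IsClairautMap (E := E) (F := F) f (fun b ↦ Real.exp (h b)))
    (hf : ContMDiff 𝓘(ℝ, E) 𝓘(ℝ, F) 2 f) (hh : MDifferentiableAt 𝓘(ℝ, F) 𝓘(ℝ, ℝ) h (f p))
    (w z : TangentSpace 𝓘(ℝ, E) p) {u : TangentSpace 𝓘(ℝ, F) (f p)}
    (hu : u ∈ (rangeAt (E := E) (F := F) f p)ᗮ) :
    inner ℝ (pushforwardCovDeriv f p w z) u =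
      -(inner ℝ (pushforward (F := F) f p w) (pushforward f p z) *
        mvfderiv 𝓘(ℝ, F) h (f p) u) := by
  obtain ⟨-, U, D, hU, hfU, hD, hDf, hgeo⟩ := hC
  obtain ⟨O, hO, hbO, k, X, hX, hXD⟩ := hD (f p) (hfU p)
  exact inner_pushforwardCovDeriv_of_isLocalClairautOn
    (isLocalClairautOn_frameCoord (fun x hx ↦ (hXD x hx).2) hgeo) (hU.inter hO) ⟨hfU p, hbO⟩
    (fun i ↦ (hX i).mono inter_subset_right) (fun x hx ↦ (hXD x hx.2).1)
    (fun q hq ↦ (hXD _ hq.2).2.trans (hDf q)) hf hh w z hu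

omit [IsManifold 𝓘(ℝ, F) ∞ B]
  [IsContMDiffRiemannianBundle 𝓘(ℝ, F) ∞ F (fun x : B ↦ TangentSpace 𝓘(ℝ, F) x)] in
lemma IsClairautUmbilical.inner_pushforwardCovDeriv
    [FiniteDimensional ℝ E] [RiemannianBundle (fun x : M ↦ TangentSpace 𝓘(ℝ, E) x)]
    (hC : IsClairautUmbilical (E := E) (F := F) f h)
    {w z : TangentSpace 𝓘(ℝ, E) p} (hw : w ∈ horizontalAt (E := E) (F := F) f p)
    (hz : z ∈ horizontalAt (E := E) (F := F) f p) {u : TangentSpace 𝓘(ℝ, F) (f p)}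
    (hu : u ∈ (rangeAt (E := E) (F := F) f p)ᗮ) :
    inner ℝ (pushforwardCovDeriv f p w z) u =
      -(inner ℝ w z * mvfderiv 𝓘(ℝ, F) h (f p) u) := by
  rw [← hC p w hw z hz u, secondFundamentalForm, inner_sub_left]
  exact (sub_eq_self.2 (Submodule.inner_right_of_mem_orthogonal
    (pushforward_mem_rangeAt _) hu)).symm

end Clairaut

end Pushforward

section LinearAlgebra

lemma eq_zero_or_finrank_range_eq_one {K V W : Type*} [Field K]
    [AddCommGroup V] [Module K V] [AddCommGroup W] [Module K W]
    {A : V →ₗ[K] W} {φ : V →ₗ[K] K} (β : V → V → K) (hβ : ∀ w, β w w = 0 → A w = 0)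
    (hφ : A.ker ≤ φ.ker) (hcomm : ∀ w z x, β w z * φ x = β w x * φ z) :
    φ = 0 ∨ Module.finrank K A.range = 1 := by
  refine or_iff_not_imp_left.2 fun hne ↦ ?_
  obtain ⟨x, hx⟩ := DFunLike.ne_iff.1 hne
  have hker : A.ker = φ.ker := by
    refine hφ.antisymm fun w hw ↦ hβ w ?_
    have h := hcomm w w x
    rw [LinearMap.mem_ker.1 hw, mul_zero] at h
    exact (mul_eq_zero.1 h).resolve_right hx
  rw [← A.quotKerEquivRange.finrank_eq, hker, φ.quotKerEquivRange.finrank_eq,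
    LinearMap.range_eq_top.2 (LinearMap.surjective hne), finrank_top, Module.finrank_self]

variable {V W : Type*} [NormedAddCommGroup V] [InnerProductSpace ℝ V]

lemma map_starProjection_orthogonal_ker [AddCommGroup W] [Module ℝ W] (A : V →ₗ[ℝ] W)
    [A.ker.HasOrthogonalProjection] (v : V) : A (A.kerᗮ.starProjection v) = A v := by
  rw [Submodule.starProjection_orthogonal_val, map_sub, LinearMap.mem_ker.1
    (A.ker.starProjection_apply_mem v), sub_zero]

lemma inner_map_map_of_isometric_orthogonal_ker [NormedAddCommGroup W] [InnerProductSpace ℝ W]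
    {A : V →ₗ[ℝ] W} [A.ker.HasOrthogonalProjection]
    (hA : ∀ v ∈ A.kerᗮ, ∀ w ∈ A.kerᗮ, (inner ℝ (A v) (A w) : ℝ) = inner ℝ v w) (v w : V) :
    inner ℝ (A v) (A w) = (inner ℝ (A.kerᗮ.starProjection v) w : ℝ) := by
  have hmem (x : V) := A.kerᗮ.starProjection_apply_mem x
  rw [← map_starProjection_orthogonal_ker A v, ← map_starProjection_orthogonal_ker A w,
    hA _ (hmem v) _ (hmem w), ← Submodule.inner_starProjection_left_eq_right,
    Submodule.starProjection_eq_self_iff.2 (hmem v)]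

end LinearAlgebra

section Dichotomy

variable {E : Type*} [NormedAddCommGroup E] [NormedSpace ℝ E]
  {M : Type*} [TopologicalSpace M] [ChartedSpace E M]
  {F : Type*} [NormedAddCommGroup F] [NormedSpace ℝ F]
  {B : Type*} [TopologicalSpace B] [ChartedSpace F B] [IsManifold 𝓘(ℝ, F) ∞ B]
  [RiemannianBundle (fun x : B ↦ TangentSpace 𝓘(ℝ, F) x)]
  {S : AlmostContactMetric F B} {f : M → B} {h : B → ℝ} {p : M}

lemma finrank_rangeAt_eq_one_or_isConstantAlongAt_of_symm
    (β : TangentSpace 𝓘(ℝ, E) p → TangentSpace 𝓘(ℝ, E) p → ℝ)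
    (hβ : ∀ w, β w w = 0 → pushforward (F := F) f p w = 0)
    (hcomm : ∀ w z x, β w z * mvfderiv 𝓘(ℝ, F) h (f p) (S.ψ (f p) (pushforward f p x)) =
      β w x * mvfderiv 𝓘(ℝ, F) h (f p) (S.ψ (f p) (pushforward f p z))) :
    Module.finrank ℝ (rangeAt (E := E) (F := F) f p) = 1 ∨
      IsConstantAlongAt (E := E) S f h p := by
  let A : TangentSpace 𝓘(ℝ, E) p →ₗ[ℝ] TangentSpace 𝓘(ℝ, F) (f p) :=
    (pushforward f p).toLinearMap
  let φ : TangentSpace 𝓘(ℝ, E) p →ₗ[ℝ] ℝ :=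
    (mvfderiv 𝓘(ℝ, F) h (f p) ∘L S.ψ (f p)).toLinearMap ∘ₗ A
  have hker : A.ker ≤ φ.ker := A.ker_le_ker_comp _
  refine (eq_zero_or_finrank_range_eq_one β hβ hker hcomm).symm.imp_right ?_
  rintro hzero _ ⟨x, rfl⟩
  exact DFunLike.congr_fun hzero x

variable [IsManifold 𝓘(ℝ, E) ∞ M] [FiniteDimensional ℝ F]
  [IsContMDiffRiemannianBundle 𝓘(ℝ, F) ∞ F (fun x : B ↦ TangentSpace 𝓘(ℝ, F) x)]
  {α β : B → ℝ}

lemma IsClairautMap.finrank_rangeAt_eq_one_or_isConstantAlongAt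
    (hC : IsClairautMap (E := E) (F := F) f (fun b ↦ Real.exp (h b)))
    (hS : S.IsTransSasakian α β) (hf : ContMDiff 𝓘(ℝ, E) 𝓘(ℝ, F) 2 f)
    (hanti : IsAntiInvariant (E := E) S f) (hξ : HasHorizontalReeb (E := E) S f)
    (hh : MDifferentiableAt 𝓘(ℝ, F) 𝓘(ℝ, ℝ) h (f p)) :
    Module.finrank ℝ (rangeAt (E := E) (F := F) f p) = 1 ∨
      IsConstantAlongAt (E := E) S f h p := by
  refine finrank_rangeAt_eq_one_or_isConstantAlongAt_of_symm
    (fun w z ↦ inner ℝ (pushforward f p w) (pushforward f p z)) (fun w ↦ inner_self_eq_zero.1)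
    fun w z x ↦ neg_injective ?_
  have hperp (v : TangentSpace 𝓘(ℝ, E) p) := hanti p _ (pushforward_mem_rangeAt v)
  rw [← hC.inner_pushforwardCovDeriv hf hh w z (hperp x),
    ← hC.inner_pushforwardCovDeriv hf hh w x (hperp z),
    hS.inner_pushforwardCovDeriv_ψ_comm hf hanti hξ]

lemma IsClairautUmbilical.finrank_rangeAt_eq_one_or_isConstantAlongAt [FiniteDimensional ℝ E]
    [RiemannianBundle (fun x : M ↦ TangentSpace 𝓘(ℝ, E) x)]
    (hC : IsClairautUmbilical (E := E) (F := F) f h)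
    (hS : S.IsTransSasakian α β) (hf : ContMDiff 𝓘(ℝ, E) 𝓘(ℝ, F) 2 f)
    (hanti : IsAntiInvariant (E := E) S f) (hξ : HasHorizontalReeb (E := E) S f) :
    Module.finrank ℝ (rangeAt (E := E) (F := F) f p) = 1 ∨
      IsConstantAlongAt (E := E) S f h p := by
  have : FiniteDimensional ℝ (TangentSpace 𝓘(ℝ, E) p) := inferInstanceAs (FiniteDimensional ℝ E)
  let P := (horizontalAt (E := E) (F := F) f p).starProjection
  have hP (v : TangentSpace 𝓘(ℝ, E) p) : P v ∈ horizontalAt f p :=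
    Submodule.starProjection_apply_mem _ v
  have hfP (v : TangentSpace 𝓘(ℝ, E) p) : pushforward (F := F) f p (P v) = pushforward f p v :=
    map_starProjection_orthogonal_ker (pushforward f p).toLinearMap v
  refine finrank_rangeAt_eq_one_or_isConstantAlongAt_of_symm (fun w z ↦ inner ℝ (P w) (P z))
    (fun w hw ↦ by rw [← hfP, inner_self_eq_zero.1 hw, map_zero]) fun w z x ↦ neg_injective ?_
  have hperp (v : TangentSpace 𝓘(ℝ, E) p) := hanti p _ (pushforward_mem_rangeAt v)
  rw [← hC.inner_pushforwardCovDeriv (hP w) (hP z) (hperp x),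
    ← hC.inner_pushforwardCovDeriv (hP w) (hP x) (hperp z), ← hfP x, ← hfP z,
    hS.inner_pushforwardCovDeriv_ψ_comm hf hanti hξ]

end Dichotomy

/-! ## The rank of a Riemannian map -/

section Rank

variable {E : Type*} [NormedAddCommGroup E] [NormedSpace ℝ E]
  {M : Type*} [TopologicalSpace M] [ChartedSpace E M] [IsManifold 𝓘(ℝ, E) ∞ M]
  [RiemannianBundle (fun x : M ↦ TangentSpace 𝓘(ℝ, E) x)]
  {F : Type*} [NormedAddCommGroup F] [NormedSpace ℝ F]
  {B : Type*} [TopologicalSpace B] [ChartedSpace F B] [IsManifold 𝓘(ℝ, F) ∞ B]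
  [RiemannianBundle (fun x : B ↦ TangentSpace 𝓘(ℝ, F) x)]
  {f : M → B} {p : M}

/-- The endomorphism `g₁⁻¹ (f^* g₂)` of the tangent spaces of the source of `f`, in the charts
centred at `p` and `f p`. For a Riemannian map it is the projection onto the horizontal spaces. -/
def pullbackMetricEnd (f : M → B) (p : M) (x : E) : E →L[ℝ] E :=
  (metricForm p x).inverse ∘L (metricForm (f p) (coordRep (F := F) (f p) f p x)).bilinearComp
    (fderiv ℝ (coordRep (F := F) (f p) f p) x) (fderiv ℝ (coordRep (F := F) (f p) f p) x)

variable [FiniteDimensional ℝ E]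
  [IsContMDiffRiemannianBundle 𝓘(ℝ, E) ∞ E (fun x : M ↦ TangentSpace 𝓘(ℝ, E) x)]

lemma IsRiemannianMap.pullbackMetricEnd_coordVec (hf : IsRiemannianMap (E := E) (F := F) f)
    {q : M} (hq : q ∈ (chartAt E p).source) (hfq : f q ∈ (chartAt F (f p)).source)
    [(horizontalAt (E := E) (F := F) f q).HasOrthogonalProjection]
    (v : TangentSpace 𝓘(ℝ, E) q) :
    pullbackMetricEnd (F := F) f p (extChartAt 𝓘(ℝ, E) p q) (coordVec p q v) =
      coordVec p q ((horizontalAt (E := E) (F := F) f q).starProjection v) := by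
  have : FiniteDimensional ℝ (TangentSpace 𝓘(ℝ, E) q) := inferInstanceAs (FiniteDimensional ℝ E)
  have hy : extChartAt 𝓘(ℝ, E) p q ∈ (extChartAt 𝓘(ℝ, E) p).target :=
    (extChartAt 𝓘(ℝ, E) p).map_source (by rwa [extChartAt_source])
  rw [pullbackMetricEnd, ContinuousLinearMap.comp_apply,
    (isMetricAt_metricForm hy).isInvertible.inverse_apply_eq]
  refine ContinuousLinearMap.ext fun z ↦ ?_
  obtain ⟨w, rfl⟩ : ∃ w, z = coordVec p q w := ⟨_, (coordVec_ofCoordVec hq z).symm⟩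
  rw [ContinuousLinearMap.bilinearComp_apply, ← inner_eq_metricForm hq,
    ← coordVec_mfderiv hq hfq (hf.1.mdifferentiable (by simp) q),
    ← coordVec_mfderiv hq hfq (hf.1.mdifferentiable (by simp) q),
    coordRep_extChartAt (f p) f hq, ← inner_eq_metricForm hfq]
  exact inner_map_map_of_isometric_orthogonal_ker
    (A := (pushforward (E := E) (F := F) f q).toLinearMap) (hf.2 q) v w

lemma IsRiemannianMap.trace_pullbackMetricEnd (hf : IsRiemannianMap (E := E) (F := F) f)
    {q : M} (hq : q ∈ (chartAt E p).source) (hfq : f q ∈ (chartAt F (f p)).source) :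
    LinearMap.trace ℝ E (pullbackMetricEnd (F := F) f p (extChartAt 𝓘(ℝ, E) p q)).toLinearMap =
      Module.finrank ℝ (rangeAt (E := E) (F := F) f q) := by
  have : FiniteDimensional ℝ (TangentSpace 𝓘(ℝ, E) q) := inferInstanceAs (FiniteDimensional ℝ E)
  obtain ⟨e, he⟩ := isInvertible_coordVec hq
  let P := (horizontalAt (E := E) (F := F) f q).starProjection
  have hconj : (pullbackMetricEnd (F := F) f p (extChartAt 𝓘(ℝ, E) p q)).toLinearMap =
      e.toLinearEquiv.conj P.toLinearMap := by
    ext z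
    have happ := hf.pullbackMetricEnd_coordVec hq hfq (e.symm z)
    rw [← he] at happ
    simpa using happ
  have hproj : LinearMap.IsProj (horizontalAt (E := E) (F := F) f q) P.toLinearMap :=
    ⟨Submodule.starProjection_apply_mem _, fun _ ↦ Submodule.starProjection_eq_self_iff.2⟩
  rw [hconj, LinearMap.trace_conj', hproj.trace]
  have hrank := (pushforward (E := E) (F := F) f q).toLinearMap.finrank_range_add_finrank_ker
  have horth := (pushforward (E := E) (F := F) f q).toLinearMap.ker.finrank_add_finrank_orthogonal
  rw [horizontalAt, rangeAt]
  norm_cast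
  lia

variable [FiniteDimensional ℝ F]
  [IsContMDiffRiemannianBundle 𝓘(ℝ, F) ∞ F (fun x : B ↦ TangentSpace 𝓘(ℝ, F) x)]

lemma continuousAt_pullbackMetricEnd (hf : ContMDiff 𝓘(ℝ, E) 𝓘(ℝ, F) 1 f) :
    ContinuousAt (pullbackMetricEnd (F := F) f p) (extChartAt 𝓘(ℝ, E) p p) := by
  have hM := isMetricAt_metricForm (mem_extChartAt_target (I := 𝓘(ℝ, E)) p)
  have hB := isMetricAt_coordRep (E := E) (F := F) (f := f) (p := p)
  have hrep := contDiffAt_coordRep_self (hf.contMDiffAt (x := p))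
  have hderiv := (hrep.fderiv_right (m := 0) (by norm_num)).continuousAt
  have hinv : ContinuousAt (fun x ↦ (metricForm p x).inverse) (extChartAt 𝓘(ℝ, E) p p) :=
    (hM.isInvertible.contDiffAt_map_inverse (n := 0)).continuousAt.comp hM.contDiffAt.continuousAt
  refine hinv.clm_comp (continuousAt_clm_apply.2 fun z ↦ continuousAt_clm_apply.2 fun z' ↦ ?_)
  exact ((hB.contDiffAt.continuousAt.comp hrep.continuousAt).clm_apply
    (hderiv.clm_apply continuousAt_const)).clm_apply (hderiv.clm_apply continuousAt_const)

lemma IsRiemannianMap.isLocallyConstant_finrank_rangeAt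
    (hf : IsRiemannianMap (E := E) (F := F) f) :
    IsLocallyConstant fun p ↦ Module.finrank ℝ (rangeAt (E := E) (F := F) f p) := by
  rw [IsLocallyConstant.iff_continuous, Nat.isClosedEmbedding_coe_real.continuous_iff,
    continuous_iff_continuousAt]
  intro p
  have htrace : Continuous fun A : E →L[ℝ] E ↦ LinearMap.trace ℝ E A.toLinearMap :=
    (LinearMap.trace ℝ E ∘ₗ ContinuousLinearMap.coeLM ℝ).continuous_of_finiteDimensional
  have hcont : ContinuousAt (fun q ↦ LinearMap.trace ℝ E
      (pullbackMetricEnd (F := F) f p (extChartAt 𝓘(ℝ, E) p q)).toLinearMap) p :=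
    htrace.continuousAt.comp
      ((continuousAt_pullbackMetricEnd (hf.1.of_le (by norm_num))).comp (continuousAt_extChartAt p))
  refine hcont.congr ?_
  filter_upwards [(chartAt E p).open_source.mem_nhds (mem_chart_source E p),
    hf.1.continuous.continuousAt.eventually_mem
      ((chartAt F (f p)).open_source.mem_nhds (mem_chart_source F (f p)))] with q hq hfq
  exact hf.trace_pullbackMetricEnd hq hfq

end Rank

theorem theorem3p3_general
    {E : Type*} [NormedAddCommGroup E] [NormedSpace ℝ E] [FiniteDimensional ℝ E]
    {M : Type*} [TopologicalSpace M] [ChartedSpace E M] [IsManifold 𝓘(ℝ, E) ∞ M]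
    [RiemannianBundle (fun x : M ↦ TangentSpace 𝓘(ℝ, E) x)]
    {F : Type*} [NormedAddCommGroup F] [NormedSpace ℝ F] [FiniteDimensional ℝ F]
    {B : Type*} [TopologicalSpace B] [ChartedSpace F B] [IsManifold 𝓘(ℝ, F) ∞ B]
    [RiemannianBundle (fun x : B ↦ TangentSpace 𝓘(ℝ, F) x)]
    [IsContMDiffRiemannianBundle 𝓘(ℝ, F) ∞ F (fun x : B ↦ TangentSpace 𝓘(ℝ, F) x)]
    (S : AlmostContactMetric F B) (α β : B → ℝ) (hS : S.IsTransSasakian α β)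
    (f : M → B) (hf : ContMDiff 𝓘(ℝ, E) 𝓘(ℝ, F) 2 f)
    (hanti : IsAntiInvariant (E := E) S f) (hξ : HasHorizontalReeb (E := E) S f)
    (h : B → ℝ) (hh : MDifferentiable 𝓘(ℝ, F) 𝓘(ℝ, ℝ) h)
    (hC : IsClairautMap (E := E) (F := F) f (fun b ↦ Real.exp (h b)) ∨
      IsClairautUmbilical (E := E) (F := F) f h) :
    (∀ p : M, Module.finrank ℝ (rangeAt (E := E) (F := F) f p) = 1 ∨
      IsConstantAlongAt (E := E) S f h p) ∧
    (PreconnectedSpace M →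
      IsLocallyConstant (fun p : M ↦ Module.finrank ℝ (rangeAt (E := E) (F := F) f p)) →
      (∀ p : M, Module.finrank ℝ (rangeAt (E := E) (F := F) f p) = 1) ∨
      (∀ p : M, IsConstantAlongAt (E := E) S f h p)) := by
  have hpoint (p : M) : Module.finrank ℝ (rangeAt (E := E) (F := F) f p) = 1 ∨
      IsConstantAlongAt (E := E) S f h p :=
    hC.elim
      (fun hC ↦ hC.finrank_rangeAt_eq_one_or_isConstantAlongAt hS hf hanti hξ (hh (f p)))
      (fun hC ↦ hC.finrank_rangeAt_eq_one_or_isConstantAlongAt hS hf hanti hξ)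
  refine ⟨hpoint, fun _ hrank ↦ ?_⟩
  by_cases hone : ∃ p : M, Module.finrank ℝ (rangeAt (E := E) (F := F) f p) = 1
  · obtain ⟨p, hp⟩ := hone
    exact .inl fun q ↦ (hrank.apply_eq_of_preconnectedSpace q p).trans hp
  · exact .inr fun p ↦ (hpoint p).resolve_left fun hp ↦ hone ⟨p, hp⟩

end

theorem theorem3p3
    {E : Type*} [NormedAddCommGroup E] [NormedSpace ℝ E] [FiniteDimensional ℝ E]
    {M : Type*} [TopologicalSpace M] [ChartedSpace E M] [IsManifold 𝓘(ℝ, E) ∞ M]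
    [RiemannianBundle (fun x : M ↦ TangentSpace 𝓘(ℝ, E) x)]
    [IsContMDiffRiemannianBundle 𝓘(ℝ, E) ∞ E (fun x : M ↦ TangentSpace 𝓘(ℝ, E) x)]
    {F : Type*} [NormedAddCommGroup F] [NormedSpace ℝ F] [FiniteDimensional ℝ F]
    {B : Type*} [TopologicalSpace B] [ChartedSpace F B] [IsManifold 𝓘(ℝ, F) ∞ B]
    [RiemannianBundle (fun x : B ↦ TangentSpace 𝓘(ℝ, F) x)]
    [IsContMDiffRiemannianBundle 𝓘(ℝ, F) ∞ F (fun x : B ↦ TangentSpace 𝓘(ℝ, F) x)]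
    (S : AlmostContactMetric F B) (α β : B → ℝ) (hS : S.IsTransSasakian α β)
    (f : M → B) (hf : IsRiemannianMap (E := E) (F := F) f)
    (hanti : IsAntiInvariant (E := E) S f) (hξ : HasHorizontalReeb (E := E) S f)
    (h : B → ℝ) (hh : ContMDiff 𝓘(ℝ, F) 𝓘(ℝ, ℝ) ∞ h)
    (hC : IsClairautMap (E := E) (F := F) f (fun b ↦ Real.exp (h b)) ∨
      IsClairautUmbilical (E := E) (F := F) f h) :
    (∀ p : M, Module.finrank ℝ (rangeAt (E := E) (F := F) f p) = 1 ∨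
      IsConstantAlongAt (E := E) S f h p) ∧
    (ConnectedSpace M →
      (∀ p : M, Module.finrank ℝ (rangeAt (E := E) (F := F) f p) = 1) ∨
      (∀ p : M, IsConstantAlongAt (E := E) S f h p)) := by
  have hgen := theorem3p3_general S α β hS f (hf.1.of_le ENat.LEInfty.out) hanti hξ h
    (hh.mdifferentiable (by simp)) hC
  exact ⟨hgen.1, fun _ ↦ hgen.2 inferInstance hf.isLocallyConstant_finrank_rangeAt⟩
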